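/- Let $X$ be a compact Hausdorff space and let $A$ be a uniform algebra on $X$, that is, a subalgebra of $C(X)$ (the algebra of complex continuous functions on $X$) that contains the constants and separates the points of $X$. Suppose that $A$ is a hypo-Dirichlet algebra: there are finitely many invertible elements $f_1,\dots,f_s$ of $A$ such that the real linear span of $\operatorname{Re}A$ and $\log|f_1|,\dots,\log|f_s|$ is uniformly dense in the space of real continuous functions on $X$. Let $\varphi$ be a (nonzero) multiplicative linear functional on $A$, and let $\mathcal M(\varphi)$ be the set of its representing measures, i.e. the positive regular Borel measures $\mu$ on $X$ with $\varphi(f)=\int_X f\,d\mu$ for all $f\in A$. Let $m\in\mathcal M(\varphi)$ be a core measure for $\varphi$: whenever $\sigma$ is a finite real signed measure with $m+\sigma\in\mathcal M(\varphi)$, then $m-\varepsilon\sigma\in\mathcal M(\varphi)$ for all sufficiently small $\varepsilon>0$. Let $H^2(m)$ be the closure of $A$ in $L^2(m)$ and $H^\infty(m)$ the weak-star closure of $A$ in $L^\infty(m)=L^1(m)^*$. Suppose that $H^2(m)$ is a reproducing kernel Hilbert space, in the sense that there is a set $\Lambda$ of multiplicative linear functionals on $A$ such that every evaluation $a\mapsto\lambda(a)$,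 $\lambda\in\Lambda$, extends from $A$ to a bounded linear functional $f\mapsto f(\lambda)$ on $H^2(m)$, and an element $f$ of $H^2(m)$ with $f(\lambda)=0$ for all $\lambda\in\Lambda$ is $0$. For $h\in H^\infty(m)$ let $T_h$ be the bounded operator $f\mapsto hf$ on $H^2(m)$. Then $\{T_h : h\in H^\infty(m)\}$ is catalytic: every unital subalgebra of $B(H^2(m))$ that contains all $T_h$, $h\in H^\infty(m)$, and is transitive (its only closed invariant subspaces are $\{0\}$ and $H^2(m)$) is dense in $B(H^2(m))$ in the strong operator topology. -/

import Mathlib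

open MeasureTheory Topology
open scoped ENNReal ComplexConjugate

noncomputable section

namespace HypoDirichlet

/-! ### Uniform algebras and hypo-Dirichlet algebras -/

section Algebras

variable {X : Type*} [TopologicalSpace X]

/-- The real part of a continuous complex-valued function. -/
def rePart (f : C(X, ℂ)) : C(X, ℝ) :=
  ⟨fun x => (f x).re, Complex.continuous_re.comp f.continuous⟩

/-- The continuous function `log |f|`, for an invertible element `f` of the algebra `A`. -/
def logAbs (A : Subalgebra ℂ C(X, ℂ)) (f : Aˣ) : C(X, ℝ) where
  toFun x := Real.log ‖(f : A).1 x‖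
  continuous_toFun := by
    refine Continuous.log (by fun_prop) fun x => ?_
    have h : (f : A).1 * ((f⁻¹ : Aˣ) : A).1 = 1 := congrArg Subtype.val f.mul_inv
    have hx := DFunLike.congr_fun h x
    intro h0
    rw [norm_eq_zero] at h0
    simp [h0] at hx

/-- A uniform algebra on `X`: a subalgebra of `C(X)` that contains the constants (as every
`Subalgebra` does) and separates the points of `X`.  It is not required to be norm closed. -/
def IsUniformAlgebra (A : Subalgebra ℂ C(X, ℂ)) : Prop :=
  A.SeparatesPoints

/-- A hypo-Dirichlet algebra: a uniform algebra with finitely many invertible elements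
`f₁, …, fₛ` such that the real linear span of `Re A` and `log |f₁|, …, log |fₛ|` is uniformly
dense in the space of real continuous functions. -/
def IsHypoDirichlet [CompactSpace X] (A : Subalgebra ℂ C(X, ℂ)) : Prop :=
  IsUniformAlgebra A ∧
    ∃ (s : ℕ) (f : Fin s → Aˣ),
      Dense (Submodule.span ℝ
        (rePart '' (A : Set C(X, ℂ)) ∪ Set.range fun i => logAbs A (f i)) : Set C(X, ℝ))

end Algebras

/-! ### Representing measures and core measures -/

/-- A core point `x` of the subset `K` of a real vector space: `x ∈ K`, and whenever `x + y ∈ K`,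
also `x - ε y ∈ K` for all sufficiently small `ε > 0`. -/
def IsCorePoint {V : Type*} [AddCommGroup V] [Module ℝ V] (K : Set V) (x : V) : Prop :=
  x ∈ K ∧ ∀ y, x + y ∈ K → ∃ δ : ℝ, 0 < δ ∧ ∀ ε : ℝ, 0 < ε → ε < δ → x - ε • y ∈ K

section Measures

variable {X : Type*} [TopologicalSpace X] [MeasurableSpace X]

/-- `m` is a representing measure for the multiplicative linear functional `φ` on `A`: a positive
regular Borel measure with `φ f = ∫ f dm` for `f ∈ A`. -/
def IsRepresenting {A : Subalgebra ℂ C(X, ℂ)} (φ : A →ₐ[ℂ] ℂ) (m : Measure X) : Prop :=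
  m.Regular ∧ ∀ f : A, φ f = ∫ x, f.1 x ∂m

/-- The set of representing measures for `φ`, as a subset of the real vector space of finite
signed measures. -/
def representingSet {A : Subalgebra ℂ C(X, ℂ)} (φ : A →ₐ[ℂ] ℂ) : Set (SignedMeasure X) :=
  {σ | ∃ (μ : Measure X) (_ : IsFiniteMeasure μ), IsRepresenting φ μ ∧ σ = μ.toSignedMeasure}

/-- `m` is a core measure for `φ`: a representing measure that is a core point of the set of all
representing measures. -/
def IsCoreMeasure {A : Subalgebra ℂ C(X, ℂ)} (φ : A →ₐ[ℂ] ℂ) (m : Measure X)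
    [IsFiniteMeasure m] : Prop :=
  IsRepresenting φ m ∧ IsCorePoint (representingSet φ) m.toSignedMeasure

end Measures

/-! ### The generalized Hardy spaces -/

section Hardy

variable {X : Type*} [TopologicalSpace X] [CompactSpace X] [MeasurableSpace X] [BorelSpace X]
  (A : Subalgebra ℂ C(X, ℂ)) (m : Measure X) [IsFiniteMeasure m]

/-- `H²(m)`: the closure of `A` in `L²(m)`. -/
def H2 : Submodule ℂ (Lp ℂ 2 m) :=
  (A.toSubmodule.map (ContinuousMap.toLp (E := ℂ) 2 m ℂ).toLinearMap).topologicalClosure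

instance : CompleteSpace (H2 A m) :=
  (Submodule.isClosed_topologicalClosure _).completeSpace_coe

/-- The class in `H²(m)` of an element of `A`. -/
def toH2 (a : A) : H2 A m :=
  ⟨ContinuousMap.toLp (E := ℂ) 2 m ℂ a.1,
    Submodule.le_topologicalClosure _ (Submodule.mem_map_of_mem a.2)⟩

/-- The weak-star topology of `L^∞(m)`, regarded as the dual of `L¹(m)`: the coarsest topology for
which `f ↦ ∫ f g dm` is continuous for every `g ∈ L¹(m)`. -/
@[reducible] def weakStarTopology : TopologicalSpace (Lp ℂ ∞ m) :=
  TopologicalSpace.induced (fun f (g : Lp ℂ 1 m) => ∫ x, f x * g x ∂m) Pi.topologicalSpace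

/-- `H^∞(m)`: the weak-star closure of `A` in `L^∞(m)`. -/
def Hinf : Set (Lp ℂ ∞ m) :=
  closure[weakStarTopology m] (ContinuousMap.toLp (E := ℂ) ∞ m ℂ '' (A : Set C(X, ℂ)))

/-- Multiplication by `h ∈ L^∞(m)`, as a bounded operator on `L²(m)`. -/
def mulL2 (h : Lp ℂ ∞ m) : Lp ℂ 2 m →L[ℂ] Lp ℂ 2 m :=
  (ContinuousLinearMap.mul ℂ ℂ).holderL m ∞ 2 2 h

theorem coeFn_mulL2 (h : Lp ℂ ∞ m) (f : Lp ℂ 2 m) :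
    mulL2 m h f =ᵐ[m] fun x => h x * f x :=
  (ContinuousLinearMap.mul ℂ ℂ).coeFn_holder (r := 2) h f

/-- `H²(m)` is invariant under multiplication by functions in `H^∞(m)`. -/
theorem mulL2_mem {h : Lp ℂ ∞ m} (hh : h ∈ Hinf A m) {f : Lp ℂ 2 m} (hf : f ∈ H2 A m) :
    mulL2 m h f ∈ H2 A m := by
  have hcl : IsClosed (H2 A m : Set (Lp ℂ 2 m)) := Submodule.isClosed_topologicalClosure _
  suffices H : ∀ a ∈ A, mulL2 m h (ContinuousMap.toLp (E := ℂ) 2 m ℂ a) ∈ H2 A m by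
    have hsub : closure ((A.toSubmodule.map
        (ContinuousMap.toLp (E := ℂ) 2 m ℂ).toLinearMap : Submodule ℂ _) : Set (Lp ℂ 2 m)) ⊆
        mulL2 m h ⁻¹' (H2 A m : Set (Lp ℂ 2 m)) := by
      refine closure_minimal ?_ (hcl.preimage (mulL2 m h).continuous)
      rintro _ ⟨a, ha, rfl⟩
      exact H a ha
    exact hsub hf
  intro a ha
  have : (H2 A m).HasOrthogonalProjection := inferInstance
  rw [← (H2 A m).orthogonal_orthogonal, Submodule.mem_orthogonal]
  intro g hg
  -- the integrable function `a ḡ`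
  have hint : MemLp (fun x => a x * conj (g x)) 1 m := by
    have h1 : MemLp (fun x => conj (g x)) 2 m := (Lp.memLp g).star
    have h2 : MemLp (fun x => a x) 2 m :=
      (Lp.memLp (ContinuousMap.toLp (E := ℂ) 2 m ℂ a)).ae_eq (ContinuousMap.coeFn_toLp m a)
    exact h1.mul h2
  set k : Lp ℂ 1 m := hint.toLp _ with hk
  have hcont : @Continuous _ _ (weakStarTopology m) _
      (fun f : Lp ℂ ∞ m => ∫ x, f x * k x ∂m) := by
    have h2 : @Continuous _ _ (weakStarTopology m) _
        (fun (f : Lp ℂ ∞ m) (g : Lp ℂ 1 m) => ∫ x, f x * g x ∂m) := continuous_induced_dom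
    exact @Continuous.comp _ _ _ (weakStarTopology m) _ _ _
      (fun p : Lp ℂ 1 m → ℂ => p k) (continuous_apply k) h2
  have hclosed : @IsClosed _ (weakStarTopology m)
      {f : Lp ℂ ∞ m | ∫ x, f x * k x ∂m = 0} :=
    @IsClosed.preimage _ _ (weakStarTopology m) _ _ hcont _ (isClosed_singleton (x := (0 : ℂ)))
  have key : h ∈ {f : Lp ℂ ∞ m | ∫ x, f x * k x ∂m = 0} := by
    refine (@IsClosed.closure_subset_iff _ (weakStarTopology m) _ _ hclosed).2 ?_ hh
    rintro _ ⟨b, hb, rfl⟩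
    have hmem : ContinuousMap.toLp (E := ℂ) 2 m ℂ (b * a) ∈ H2 A m :=
      Submodule.le_topologicalClosure _ (Submodule.mem_map_of_mem (A.mul_mem hb ha))
    have h0 := (Submodule.mem_orthogonal' _ _).1 hg _ hmem
    rw [L2.inner_def] at h0
    change ∫ x, _ ∂m = 0
    rw [← h0]
    refine integral_congr_ae ?_
    filter_upwards [ContinuousMap.coeFn_toLp (p := ∞) (𝕜 := ℂ) m b,
      ContinuousMap.coeFn_toLp (p := 2) (𝕜 := ℂ) m (b * a), hint.coeFn_toLp] with x h1 h2 h3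
    rw [h1, h2, hk, h3]
    simp only [RCLike.inner_apply, ContinuousMap.mul_apply]
    ring
  rw [L2.inner_def, ← (show ∫ x, h x * k x ∂m = 0 from key)]
  refine integral_congr_ae ?_
  filter_upwards [ContinuousMap.coeFn_toLp (p := 2) (𝕜 := ℂ) m a, hint.coeFn_toLp,
    coeFn_mulL2 m h (ContinuousMap.toLp (E := ℂ) 2 m ℂ a)] with x h1 h2 h3
  rw [h3, h1, hk, h2]
  simp only [RCLike.inner_apply]
  ring

/-- The multiplication operator `T_h f = h f` on `H²(m)`, for `h ∈ H^∞(m)`. -/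
def mulH2 (h : Hinf A m) : H2 A m →L[ℂ] H2 A m :=
  ((mulL2 m h.1).comp (H2 A m).subtypeL).codRestrict (H2 A m) fun f => mulL2_mem A m h.2 f.2

/-- `H²(m)` is a reproducing kernel Hilbert space: for some set `Λ` of multiplicative linear
functionals on `A`, it is a Hilbert space of functions on `Λ` with continuous point evaluations
(functions being determined by their values on `Λ`), in which each `a ∈ A` is the function
`l ↦ l a`. -/
def IsReproducingKernel : Prop :=
  ∃ (Λ : Set (A →ₐ[ℂ] ℂ)) (R : RKHS ℂ (H2 A m) Λ ℂ),
    ∀ (a : A) (l : Λ), R.coeCLM (toH2 A m a) l = l.1 a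

end Hardy

/-! ### Transitive, strongly dense and catalytic -/

section Operators

variable {H : Type*} [NormedAddCommGroup H] [InnerProductSpace ℂ H]

/-- A (unital) algebra of bounded operators is transitive if its only closed invariant subspaces
are the trivial ones. -/
def IsTransitive (T : Subalgebra ℂ (H →L[ℂ] H)) : Prop :=
  ∀ V : Submodule ℂ H, IsClosed (V : Set H) → (∀ S ∈ T, ∀ v ∈ V, S v ∈ V) → V = ⊥ ∨ V = ⊤

/-- Density in `B(H)` for the strong operator topology, the topology of pointwise convergence
`H →Lₚₜ[ℂ] H`. -/
def IsStronglyDense (T : Set (H →L[ℂ] H)) : Prop :=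
  Dense (ContinuousLinearMap.toPointwiseConvergenceCLM ℂ (RingHom.id ℂ) H H '' T)

/-- A set of operators is catalytic if every transitive algebra containing it is strongly dense. -/
def IsCatalytic (S : Set (H →L[ℂ] H)) : Prop :=
  ∀ T : Subalgebra ℂ (H →L[ℂ] H), S ⊆ T → IsTransitive T →
    IsStronglyDense (T : Set (H →L[ℂ] H))

end Operators

end HypoDirichlet

end

set_option linter.unusedSectionVars false

/-! By Arveson's criterion (`isStronglyDense_of_hasScalarTransformations`), a transitive algebra `T`
is strongly dense once every linear transformation that commutes with `T` on a `T`-invariant linear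
manifold, closed or not, is a scalar. Such a manifold `D` may contain no bounded function, so each
of its elements must first be made bounded by multiplication, without losing its integral.

The core property gives this. If `μ` represents `φ`, then moving from `m` a little away from `μ`
stays among positive measures, so `μ` is at most a multiple of `m`. The hypo-Dirichlet condition
lets a representing measure vary in only finitely many real parameters, so one constant `C` serves
all `μ`. By Hahn–Banach and Riesz duality, every continuous `v ≥ 0` lies below some `Re a` with `Re
φ(a)` nearly at most `C ∫ v dm`; exponentiating `-a` gives `b ∈ A` with `|b| ≤ exp(-v)` and `φ(b)`
bounded below. For `f = ∑ dₙ` in `H²(m)`, take `v = log(1 + |dₙ|)` for each `n`: the infinite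
product of the resulting `bₙ` is a `b` in `H^∞(m)` with nonzero integral and `bf` in `H^∞(m)`
(`IsCoreMeasure.exists_bounded_multiplier`).

Let `L` commute with `T` on `D`. With such multipliers `b`, `d` for `f`, `g`, the identity `(bf)(dg)
= (dg)(bf)`, pushed through `L` and integrated, yields `∫f ∫Lg = ∫g ∫Lf`, since the integral is
multiplicative on `H^∞(m) × H²(m)`. Hence for a suitable scalar `c` the range of `L - c` lies in the
kernel of the integral. It is invariant and not dense, so transitivity makes it zero. -/

namespace HypoDirichlet

/-! ### Arveson's density criterion for transitive algebras. -/

section Transitive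

variable {H : Type*} [NormedAddCommGroup H] [InnerProductSpace ℂ H]

/-- Inserting a zero as `j`-th coordinate. -/
def insertZero (H : Type*) [AddCommGroup H] [Module ℂ H] {n : ℕ} (j : Fin (n + 1)) :
    (Fin n → H) →ₗ[ℂ] (Fin (n + 1) → H) where
  toFun y := j.insertNth 0 y
  map_add' y z := by
    ext i
    refine Fin.succAboveCases j ?_ (fun k => ?_) i <;> simp
  map_smul' c y := by
    ext i
    refine Fin.succAboveCases j ?_ (fun k => ?_) i <;> simp

@[simp] theorem insertZero_same {n : ℕ} (j : Fin (n + 1)) (y : Fin n → H) :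
    insertZero H j y j = 0 := by simp [insertZero]

@[simp] theorem insertZero_succAbove {n : ℕ} (j : Fin (n + 1)) (y : Fin n → H) (i : Fin n) :
    insertZero H j y (j.succAbove i) = y i := by simp [insertZero]

theorem continuous_insertZero {n : ℕ} (j : Fin (n + 1)) : Continuous (insertZero H j) := by
  refine continuous_pi fun i => ?_
  refine Fin.succAboveCases j ?_ (fun k => ?_) i
  · simpa using continuous_const
  · simpa using continuous_apply k

theorem insertZero_restrict {n : ℕ} (j : Fin (n + 1)) {u : Fin (n + 1) → H} (hu : u j = 0) :
    insertZero H j (fun i => u (j.succAbove i)) = u := by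
  ext i
  refine Fin.succAboveCases j ?_ (fun k => ?_) i <;> simp [hu]

theorem comp_insertZero {n : ℕ} (j : Fin (n + 1)) (S : H →L[ℂ] H) (y : Fin n → H) :
    insertZero H j (fun i => S (y i)) = fun i => S (insertZero H j y i) := by
  ext i
  refine Fin.succAboveCases j ?_ (fun k => ?_) i <;> simp

/-- A subspace of `Hⁿ` is invariant under the diagonal action of `T`. -/
def IsDiagInvariant (T : Subalgebra ℂ (H →L[ℂ] H)) {n : ℕ} (M : Submodule ℂ (Fin n → H)) : Prop :=
  ∀ S ∈ T, ∀ v ∈ M, (fun i => S (v i)) ∈ M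

/-- Every linear transformation, defined on a `T`-invariant linear manifold and commuting with
`T`, is a scalar. -/
def HasScalarTransformations (T : Subalgebra ℂ (H →L[ℂ] H)) : Prop :=
  ∀ (D : Submodule ℂ H) (L : D →ₗ[ℂ] H) (hD : ∀ S ∈ T, ∀ v ∈ D, S v ∈ D),
    (∀ S (hS : S ∈ T) (v : D), L ⟨S v, hD S hS v v.2⟩ = S (L v)) → ∃ c : ℂ, ∀ v : D, L v = c • (v : H)

/-- The scalar relations between the coordinates of the elements of `M`. -/
def relations {n : ℕ} (M : Submodule ℂ (Fin n → H)) : Submodule ℂ (Fin n → ℂ) where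
  carrier := {c | ∀ u ∈ M, ∑ i, c i • u i = 0}
  add_mem' {c d} hc hd u hu := by
    simp [add_smul, Finset.sum_add_distrib, hc u hu, hd u hu]
  zero_mem' u _ := by simp
  smul_mem' t c hc u hu := by
    simp [mul_smul, ← Finset.smul_sum, hc u hu]

/-- The relations form a proper subspace, for otherwise each coordinate would vanish on `K`. The
coordinates of a nonzero functional killing them form a vector `w` for which every `w ⊗ x` satisfies
all relations. -/
theorem exists_smul_mem_of_ne_bot {n : ℕ} {K : Submodule ℂ (Fin n → H)} (hK : K ≠ ⊥)
    (h : ∀ v, (∀ c ∈ relations K, ∑ i, c i • v i = 0) → v ∈ K) :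
    ∃ w : Fin n → ℂ, w ≠ 0 ∧ ∀ x : H, (fun i => w i • x) ∈ K := by
  have hR : relations K < ⊤ := by
    refine lt_top_iff_ne_top.2 fun htop => hK ?_
    refine (Submodule.eq_bot_iff _).2 fun u hu => funext fun i => ?_
    have h1 : (Pi.single i 1 : Fin n → ℂ) ∈ relations K := htop ▸ Submodule.mem_top
    simpa [Pi.single_apply, ite_smul] using h1 u hu
  obtain ⟨f, hf0, hf⟩ := Submodule.exists_le_ker_of_lt_top _ hR
  have hf' : ∀ c, f c = ∑ i, c i • f (Pi.single i 1) := fun c => by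
    rw [LinearMap.pi_apply_eq_sum_univ f c]
    refine Finset.sum_congr rfl fun i _ => ?_
    congr 2
    ext j
    simp [Pi.single_apply, eq_comm]
  refine ⟨fun i => f (Pi.single i 1), fun h0 => hf0 ?_, fun x => h _ fun c hc => ?_⟩
  · ext i
    simpa using congrFun h0 i
  · have h1 : f c = 0 := hf hc
    rw [hf'] at h1
    simp only [← mul_smul]
    rw [← Finset.sum_smul]
    simp only [smul_eq_mul] at h1
    rw [h1, zero_smul]

/-- Since `M` contains `w ⊗ H` and `w j ≠ 0`, subtracting `w ⊗ (w j)⁻¹ u j` clears the `j`-th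
coordinate without affecting membership in `M`. This reduces the question to one coordinate fewer.
-/
theorem mem_of_relations_of_smul_mem {n : ℕ}
    {M : Submodule ℂ (Fin (n + 1) → H)} {w : Fin (n + 1) → ℂ} {j : Fin (n + 1)} (hj : w j ≠ 0)
    (hw : ∀ x : H, (fun i => w i • x) ∈ M)
    (ih : ∀ v, (∀ c ∈ relations (M.comap (insertZero H j)), ∑ i, c i • v i = 0) →
      v ∈ M.comap (insertZero H j))
    {v : Fin (n + 1) → H} (hv : ∀ c ∈ relations M, ∑ i, c i • v i = 0) : v ∈ M := by
  have key : ∀ u : Fin (n + 1) → H, insertZero H j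
      (fun i => (u - fun k => w k • ((w j)⁻¹ • u j)) (j.succAbove i)) =
        u - fun k => w k • ((w j)⁻¹ • u j) := fun u =>
    insertZero_restrict j (by simp [smul_smul, hj])
  have hmem : ∀ u : Fin (n + 1) → H,
      (fun i => (u - fun k => w k • ((w j)⁻¹ • u j)) (j.succAbove i)) ∈
        M.comap (insertZero H j) ↔ u ∈ M := fun u => by
    rw [Submodule.mem_comap, key]
    exact Submodule.sub_mem_iff_left _ (hw _)
  rw [← hmem]
  refine ih _ fun c hc => ?_
  -- The `j`-th coefficient is the one that makes `c'` annihilate `w`; this extends a relation of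
  -- the slice to a relation of `M`.
  set c' : Fin (n + 1) → ℂ := j.insertNth (-(w j)⁻¹ * ∑ i, c i * w (j.succAbove i)) c with hc'
  have hsum : ∀ u : Fin (n + 1) → H, ∑ i, c' i • u i =
      ∑ i, c i • (u - fun k => w k • ((w j)⁻¹ • u j)) (j.succAbove i) := fun u => by
    rw [Fin.sum_univ_succAbove _ j]
    simp only [hc', Fin.insertNth_apply_same, Fin.insertNth_apply_succAbove, Pi.sub_apply,
      smul_sub, Finset.sum_sub_distrib, smul_smul]
    rw [← Finset.sum_smul, Finset.mul_sum, add_comm, sub_eq_add_neg, ← neg_smul,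
      ← Finset.sum_neg_distrib]
    congr 2
    exact Finset.sum_congr rfl fun i _ => by ring
  rw [← hsum]
  refine hv c' fun u hu => ?_
  rw [hsum]
  exact hc _ ((hmem u).2 hu)

/-- Here `M` is a graph over coordinate `0`. The other coordinates are transformations commuting
with `T`, hence scalars `c i`, so `M` lies in `c ⊗ H`. The `x` with `c ⊗ x ∈ M` form a closed
invariant subspace, to which transitivity applies. -/
theorem mem_of_relations_of_graph {T : Subalgebra ℂ (H →L[ℂ] H)} (hT : IsTransitive T)
    (hL : HasScalarTransformations T) {n : ℕ} {M : Submodule ℂ (Fin (n + 1) → H)}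
    (hM : IsClosed (M : Set (Fin (n + 1) → H))) (hinv : IsDiagInvariant T M)
    (hgraph : ∀ u ∈ M, u 0 = 0 → u = 0)
    {v : Fin (n + 1) → H} (hv : ∀ c ∈ relations M, ∑ i, c i • v i = 0) : v ∈ M := by
  set P : M →ₗ[ℂ] H := (LinearMap.proj 0).comp M.subtype with hP
  have hPinj : Function.Injective P := by
    rw [injective_iff_map_eq_zero]
    intro u hu
    exact Subtype.ext (hgraph u u.2 hu)
  set e := LinearEquiv.ofInjective P hPinj with he
  have he_apply : ∀ u : M, (e u : H) = u.1 0 := fun u => rfl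
  have hD : ∀ S ∈ T, ∀ x ∈ LinearMap.range P, S x ∈ LinearMap.range P := by
    rintro S hS _ ⟨u, rfl⟩
    exact ⟨⟨_, hinv S hS u u.2⟩, rfl⟩
  have hscal : ∀ i, ∃ c : ℂ, ∀ u ∈ M, u i = c • u 0 := fun i => by
    obtain ⟨c, hc⟩ := hL (LinearMap.range P)
      (((LinearMap.proj i).comp M.subtype).comp e.symm.toLinearMap) hD fun S hS x => by
        obtain ⟨u, rfl⟩ := e.surjective x
        have : (⟨S (e u), hD S hS _ (e u).2⟩ : LinearMap.range P) =
            e ⟨_, hinv S hS u u.2⟩ := Subtype.ext rfl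
        rw [this]
        simp
    refine ⟨c, fun u hu => ?_⟩
    simpa [he_apply] using hc (e ⟨u, hu⟩)
  choose c hc using hscal
  have hvc : v = fun i => c i • v 0 := by
    ext i
    have hrel : (Pi.single i 1 - c i • Pi.single 0 1 : Fin (n + 1) → ℂ) ∈ relations M := by
      intro u hu
      simp [sub_smul, Finset.sum_sub_distrib, Pi.single_apply, ite_smul, hc i u hu]
    have := hv _ hrel
    simpa [sub_smul, Finset.sum_sub_distrib, Pi.single_apply, ite_smul, sub_eq_zero] using this
  let E : H →ₗ[ℂ] (Fin (n + 1) → H) := LinearMap.pi fun i => c i • LinearMap.id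
  have hE : ∀ x, E x = fun i => c i • x := fun x => rfl
  have hclosed : IsClosed (M.comap E : Set H) := by
    refine hM.preimage (continuous_pi fun i => ?_)
    exact continuous_const_smul (c i)
  have hEinv : ∀ S ∈ T, ∀ x ∈ M.comap E, S x ∈ M.comap E := fun S hS x hx => by
    have := hinv S hS _ hx
    rw [Submodule.mem_comap, hE]
    simpa [hE] using this
  rw [hvc, ← hE, ← Submodule.mem_comap]
  rcases hT _ hclosed hEinv with h | h
  · have h0 : ∀ u ∈ M, u 0 = 0 := fun u hu => by
      have h1 : u 0 ∈ M.comap E := by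
        rw [Submodule.mem_comap, hE]
        convert hu using 1
        exact funext fun i => (hc i u hu).symm
      simpa [h] using h1
    have hrel : (Pi.single 0 1 : Fin (n + 1) → ℂ) ∈ relations M := by
      intro u hu
      simp [Pi.single_apply, ite_smul, h0 u hu]
    have := hv _ hrel
    have hv0 : v 0 = 0 := by simpa [Pi.single_apply, ite_smul] using this
    rw [hv0]
    exact zero_mem _
  · rw [h]
    exact Submodule.mem_top

/-- A closed diagonally invariant subspace of `Hⁿ` is cut out by its scalar relations. -/
theorem mem_of_relations {T : Subalgebra ℂ (H →L[ℂ] H)} (hT : IsTransitive T)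
    (hL : HasScalarTransformations T) : ∀ {n : ℕ} {M : Submodule ℂ (Fin n → H)},
    IsClosed (M : Set (Fin n → H)) → IsDiagInvariant T M →
    ∀ v, (∀ c ∈ relations M, ∑ i, c i • v i = 0) → v ∈ M := by
  intro n
  induction n with
  | zero =>
    intro M _ _ v _
    rw [Subsingleton.elim v 0]
    exact zero_mem M
  | succ n ih =>
    intro M hM hinv v hv
    have ih' : ∀ j v, (∀ c ∈ relations (M.comap (insertZero H j)), ∑ i, c i • v i = 0) →
        v ∈ M.comap (insertZero H j) := fun j => by
      refine ih (hM.preimage (continuous_insertZero j)) fun S hS y hy => ?_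
      rw [Submodule.mem_comap, comp_insertZero]
      exact hinv S hS _ hy
    -- Either `M` is a graph over coordinate `0`, or its slice there is nonzero and, by induction,
    -- contains some `w ⊗ H`.
    by_cases hK : M.comap (insertZero H 0) = ⊥
    · refine mem_of_relations_of_graph hT hL hM hinv (fun u hu hu0 => ?_) hv
      have h1 : (fun i => u ((0 : Fin (n + 1)).succAbove i)) ∈ M.comap (insertZero H 0) := by
        rw [Submodule.mem_comap, insertZero_restrict 0 hu0]
        exact hu
      rw [hK, Submodule.mem_bot] at h1
      rw [← insertZero_restrict 0 hu0, h1, map_zero]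
    · obtain ⟨w, hw0, hw⟩ := exists_smul_mem_of_ne_bot hK (ih' 0)
      obtain ⟨k, hk⟩ := Function.ne_iff.1 hw0
      refine mem_of_relations_of_smul_mem (w := (0 : Fin (n + 1)).insertNth 0 w)
        (j := (0 : Fin (n + 1)).succAbove k) (by simpa using hk) (fun x => ?_)
        (ih' _) hv
      have := hw x
      rw [Submodule.mem_comap] at this
      convert this using 1
      ext i
      refine Fin.succAboveCases 0 ?_ (fun k => ?_) i
      · rw [insertZero_same]; simp
      · rw [insertZero_succAbove]; simp

/-- Arveson's density criterion. -/
theorem isStronglyDense_of_hasScalarTransformations {T : Subalgebra ℂ (H →L[ℂ] H)}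
    (hT : IsTransitive T) (hL : HasScalarTransformations T) :
    IsStronglyDense (T : Set (H →L[ℂ] H)) := by
  intro B
  rw [(PointwiseConvergenceCLM.isEmbedding_coeFn (RingHom.id ℂ) H H).isInducing.closure_eq_preimage_closure_image,
    Set.mem_preimage, mem_closure_iff_nhds]
  intro U hU
  rw [nhds_pi, Filter.mem_pi'] at hU
  obtain ⟨I, V, hV, hVU⟩ := hU
  set x : Fin I.card → H := fun i => (I.equivFin.symm i : H) with hx
  let orbit : (H →L[ℂ] H) →ₗ[ℂ] (Fin I.card → H) :=
    LinearMap.pi fun i => (ContinuousLinearMap.apply ℂ H (x i)).toLinearMap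
  have horbit : ∀ S, orbit S = fun i => S (x i) := fun S => rfl
  set N : Submodule ℂ (Fin I.card → H) := T.toSubmodule.map orbit with hN
  have hinv : IsDiagInvariant T N.topologicalClosure := by
    intro S hS v hv
    have hcont : Continuous fun v : Fin I.card → H => fun i => S (v i) :=
      continuous_pi fun i => S.continuous.comp (continuous_apply i)
    refine map_mem_closure hcont hv ?_
    rintro _ ⟨S', hS', rfl⟩
    exact ⟨S * S', T.mul_mem hS hS', rfl⟩
  have hmem : (fun i => B (x i)) ∈ N.topologicalClosure := by
    refine mem_of_relations hT hL N.isClosed_topologicalClosure hinv _ fun c hc => ?_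
    -- The orbit contains `x` itself, through the identity of `T`; so each of its relations holds
    -- for `x` and, by linearity, for its image under `B`.
    have h1 := hc x (N.le_topologicalClosure ⟨1, T.one_mem, rfl⟩)
    simpa using congrArg B h1
  have hW : Set.univ.pi (fun i => V (x i)) ∈ 𝓝 (fun i => B (x i)) :=
    set_pi_mem_nhds Set.finite_univ fun i _ => hV (x i)
  obtain ⟨_, hS1, S, hS, rfl⟩ := mem_closure_iff_nhds.1 hmem _ hW
  refine ⟨S, hVU fun y hy => ?_, _, ⟨S, hS, rfl⟩, rfl⟩
  have := hS1 (I.equivFin ⟨y, hy⟩) (Set.mem_univ _)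
  simpa [hx, horbit] using this

end Transitive

end HypoDirichlet
namespace HypoDirichlet

/-! ### Representing measures and the duality with `Re A`. -/

section RepresentingMeasures

variable {X : Type*} [TopologicalSpace X] [CompactSpace X] [MeasurableSpace X] [BorelSpace X]

theorem integrable_continuousMap {E : Type*} [NormedAddCommGroup E] (μ : Measure X)
    [IsFiniteMeasure μ] (f : C(X, E)) [SecondCountableTopologyEither X E] : Integrable f μ :=
  f.continuous.integrable_of_hasCompactSupport (HasCompactSupport.of_compactSpace _)

/-- Integration against a finite measure, as a continuous functional. -/
noncomputable def integralCM (μ : Measure X) [IsFiniteMeasure μ] : C(X, ℝ) →L[ℝ] ℝ :=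
  LinearMap.mkContinuous
    { toFun := fun g => ∫ x, g x ∂μ
      map_add' := fun g h =>
        integral_add (integrable_continuousMap μ g) (integrable_continuousMap μ h)
      map_smul' := fun c g => integral_const_mul c _ }
    (μ.real Set.univ) fun g => by
      rw [mul_comm]
      exact norm_integral_le_of_norm_le_const (Filter.Eventually.of_forall g.norm_coe_le_norm)

@[simp] theorem integralCM_apply (μ : Measure X) [IsFiniteMeasure μ] (g : C(X, ℝ)) :
    integralCM μ g = ∫ x, g x ∂μ := rfl

theorem integralCM_mono (μ : Measure X) [IsFiniteMeasure μ] {g h : C(X, ℝ)} (hgh : g ≤ h) :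
    integralCM μ g ≤ integralCM μ h :=
  integral_mono (integrable_continuousMap μ g) (integrable_continuousMap μ h) hgh

variable {A : Subalgebra ℂ C(X, ℂ)} {φ : A →ₐ[ℂ] ℂ}

theorem functional_add (φ : A →ₐ[ℂ] ℂ) (a b : A) : φ (a + b) = φ a + φ b :=
  φ.toLinearMap.map_add a b

theorem functional_smul (φ : A →ₐ[ℂ] ℂ) (c : ℂ) (a : A) : φ (c • a) = c * φ a :=
  φ.toLinearMap.map_smul c a

theorem IsRepresenting.integralCM_rePart {μ : Measure X} [IsFiniteMeasure μ]
    (hμ : IsRepresenting φ μ) (a : A) : integralCM μ (rePart a.1) = (φ a).re := by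
  rw [hμ.2 a]
  exact integral_re (integrable_continuousMap μ a.1)

theorem IsRepresenting.isProbabilityMeasure {μ : Measure X} [IsFiniteMeasure μ]
    (hμ : IsRepresenting φ μ) : IsProbabilityMeasure μ := by
  have h := hμ.2 1
  rw [map_one] at h
  have h1 : (1 : ℂ) = μ.real Set.univ := by simpa using h
  constructor
  have h2 : μ.real Set.univ = 1 := by exact_mod_cast h1.symm
  rwa [measureReal_def, ENNReal.toReal_eq_one_iff] at h2

variable (φ) in
/-- The infimum of `Re φ(a)` over the `a ∈ A` with `Re a ≥ g`. -/
noncomputable def upperEnvelope (g : C(X, ℝ)) : ℝ :=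
  sInf {r | ∃ a : A, g ≤ rePart a.1 ∧ (φ a).re = r}

theorem upperEnvelope_set_nonempty (g : C(X, ℝ)) :
    {r | ∃ a : A, g ≤ rePart a.1 ∧ (φ a).re = r}.Nonempty := by
  refine ⟨_, algebraMap ℂ A (‖g‖ : ℂ), fun x => ?_, rfl⟩
  simpa [rePart] using (le_abs_self _).trans (g.norm_coe_le_norm x)

/-- A representing measure bounds the set below, so that `sInf` is a genuine infimum; hence its
presence in the lemmas on the envelope. -/
theorem IsRepresenting.upperEnvelope_le {μ : Measure X} [IsFiniteMeasure μ]
    (hμ : IsRepresenting φ μ) {g : C(X, ℝ)} {a : A} (h : g ≤ rePart a.1) :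
    upperEnvelope φ g ≤ (φ a).re := by
  refine csInf_le ⟨integralCM μ g, ?_⟩ ⟨a, h, rfl⟩
  rintro _ ⟨a, ha, rfl⟩
  rw [← hμ.integralCM_rePart a]
  exact integralCM_mono μ ha

theorem exists_lt_of_upperEnvelope_lt {g : C(X, ℝ)} {r : ℝ} (h : upperEnvelope φ g < r) :
    ∃ a : A, g ≤ rePart a.1 ∧ (φ a).re < r := by
  obtain ⟨_, ⟨a, ha, rfl⟩, h1⟩ := exists_lt_of_csInf_lt (upperEnvelope_set_nonempty g) h
  exact ⟨a, ha, h1⟩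

theorem IsRepresenting.upperEnvelope_add_le {μ : Measure X} [IsFiniteMeasure μ]
    (hμ : IsRepresenting φ μ) (g h : C(X, ℝ)) :
    upperEnvelope φ (g + h) ≤ upperEnvelope φ g + upperEnvelope φ h := by
  refine le_of_forall_pos_lt_add fun ε hε => ?_
  obtain ⟨a, ha, ha'⟩ := exists_lt_of_upperEnvelope_lt
    (show upperEnvelope φ g < upperEnvelope φ g + ε / 2 by linarith)
  obtain ⟨b, hb, hb'⟩ := exists_lt_of_upperEnvelope_lt
    (show upperEnvelope φ h < upperEnvelope φ h + ε / 2 by linarith)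
  have h1 : upperEnvelope φ (g + h) ≤ (φ (a + b)).re :=
    hμ.upperEnvelope_le fun x => add_le_add (ha x) (hb x)
  rw [functional_add, Complex.add_re] at h1
  linarith

theorem rePart_ofReal_smul (c : ℝ) (a : A) (x : X) :
    rePart (((c : ℂ) • a : A) : C(X, ℂ)) x = c * rePart a.1 x := by
  simp [rePart]

theorem IsRepresenting.upperEnvelope_smul_le {μ : Measure X} [IsFiniteMeasure μ]
    (hμ : IsRepresenting φ μ) {c : ℝ} (hc : 0 < c) (g : C(X, ℝ)) :
    upperEnvelope φ (c • g) ≤ c * upperEnvelope φ g := by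
  refine le_of_forall_pos_lt_add fun ε hε => ?_
  obtain ⟨a, ha, ha'⟩ := exists_lt_of_upperEnvelope_lt
    (show upperEnvelope φ g < upperEnvelope φ g + ε / c by linarith [div_pos hε hc])
  have h1 : upperEnvelope φ (c • g) ≤ (φ ((c : ℂ) • a)).re := by
    refine hμ.upperEnvelope_le fun x => ?_
    change c * g x ≤ rePart (((c : ℂ) • a : A) : C(X, ℂ)) x
    rw [rePart_ofReal_smul]
    exact mul_le_mul_of_nonneg_left (ha x) hc.le
  rw [functional_smul, Complex.re_ofReal_mul] at h1
  have h2 := mul_lt_mul_of_pos_left ha' hc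
  rw [mul_add, mul_div_cancel₀ _ hc.ne'] at h2
  exact h1.trans_lt h2

theorem IsRepresenting.upperEnvelope_smul {μ : Measure X} [IsFiniteMeasure μ]
    (hμ : IsRepresenting φ μ) {c : ℝ} (hc : 0 < c) (g : C(X, ℝ)) :
    upperEnvelope φ (c • g) = c * upperEnvelope φ g := by
  refine le_antisymm (hμ.upperEnvelope_smul_le hc g) ?_
  have h := hμ.upperEnvelope_smul_le (inv_pos.2 hc) (c • g)
  rw [smul_smul, inv_mul_cancel₀ hc.ne', one_smul] at h
  have h2 := mul_le_mul_of_nonneg_left h hc.le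
  rwa [← mul_assoc, mul_inv_cancel₀ hc.ne', one_mul] at h2

theorem IsRepresenting.upperEnvelope_zero {μ : Measure X} [IsFiniteMeasure μ]
    (hμ : IsRepresenting φ μ) : upperEnvelope φ (0 : C(X, ℝ)) = 0 := by
  have h := hμ.upperEnvelope_smul (c := 2) (by norm_num) 0
  rw [smul_zero] at h
  linarith

/-- Comparing `-g` with `Re 0` gives positivity, so Riesz supplies a measure. Domination at both `a`
and `-a` forces `l (Re a) = Re φ(a)`; applying this to `-i a` recovers imaginary parts. -/
theorem exists_isRepresenting_of_le_upperEnvelope [T2Space X] {m : Measure X} [IsFiniteMeasure m]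
    (hm : IsRepresenting φ m) (l : C(X, ℝ) →ₗ[ℝ] ℝ) (hl : ∀ g, l g ≤ upperEnvelope φ g) :
    ∃ (μ : Measure X) (_ : IsFiniteMeasure μ), IsRepresenting φ μ ∧ ∀ g, integralCM μ g = l g := by
  have hpos : ∀ g : C(X, ℝ), 0 ≤ g → 0 ≤ l g := fun g hg => by
    have h1 : l (-g) ≤ (φ 0).re := (hl _).trans (hm.upperEnvelope_le fun x => by
      simpa [rePart] using hg x)
    simpa using h1
  let Λ : CompactlySupportedContinuousMap X ℝ →ₚ[ℝ] ℝ :=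
    PositiveLinearMap.mk₀
      { toFun := fun g => l g.toContinuousMap
        map_add' := fun g h => l.map_add g.toContinuousMap h.toContinuousMap
        map_smul' := fun c g => l.map_smul c g.toContinuousMap } fun g hg => hpos _ hg
  have hint : ∀ g : C(X, ℝ), ∫ x, g x ∂(RealRMK.rieszMeasure Λ) = l g := fun g =>
    RealRMK.integral_rieszMeasure Λ ⟨g, HasCompactSupport.of_compactSpace _⟩
  refine ⟨RealRMK.rieszMeasure Λ, inferInstance, ⟨inferInstance, fun a => ?_⟩, hint⟩
  have hre : ∀ a : A, l (rePart a.1) = (φ a).re := fun a => by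
    refine le_antisymm ((hl _).trans (hm.upperEnvelope_le le_rfl)) ?_
    have h1 : l (rePart (-a).1) ≤ (φ (-a)).re := (hl _).trans (hm.upperEnvelope_le le_rfl)
    have h2 : rePart (-a).1 = -rePart a.1 := by ext; simp [rePart]
    rw [h2, map_neg, map_neg, Complex.neg_re] at h1
    linarith
  have hre' : ∀ a : A, (φ a).re = (∫ x, a.1 x ∂(RealRMK.rieszMeasure Λ)).re := fun a => by
    rw [← hre, ← hint]
    exact integral_re (integrable_continuousMap _ a.1)
  refine Complex.ext (hre' a) ?_
  have h := hre' (-Complex.I • a)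
  have h2 : ∫ x, (-Complex.I • a : A).1 x ∂(RealRMK.rieszMeasure Λ) =
      -Complex.I * ∫ x, a.1 x ∂(RealRMK.rieszMeasure Λ) := integral_const_mul _ _
  rw [h2, functional_smul] at h
  simpa using h

/-- Hahn–Banach, extending from the line through `v` under the sublinear envelope: the infimum over
`A` is attained as an integral. -/
theorem IsRepresenting.exists_integral_eq_upperEnvelope [T2Space X] {m : Measure X}
    [IsFiniteMeasure m] (hm : IsRepresenting φ m) (v : C(X, ℝ)) :
    ∃ (μ : Measure X) (_ : IsFiniteMeasure μ), IsRepresenting φ μ ∧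
      integralCM μ v = upperEnvelope φ v := by
  rcases eq_or_ne v 0 with rfl | hv
  · exact ⟨m, inferInstance, hm, by rw [hm.upperEnvelope_zero, map_zero]⟩
  obtain ⟨l, hl1, hl2⟩ := exists_extension_of_le_sublinear
    (LinearPMap.mkSpanSingleton v (upperEnvelope φ v) hv) (upperEnvelope φ)
    (fun c hc x => hm.upperEnvelope_smul hc x) hm.upperEnvelope_add_le (by
      rintro ⟨_, hx⟩
      obtain ⟨c, rfl⟩ := Submodule.mem_span_singleton.1 hx
      rw [LinearPMap.mkSpanSingleton'_apply]
      simp only [RingHom.id_apply, smul_eq_mul]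
      rcases lt_trichotomy c 0 with hc | rfl | hc
      -- For `c < 0`, subadditivity at `c v` and `-c v`, which sum to `0`, gives the bound.
      · have h1 := hm.upperEnvelope_smul (neg_pos.2 hc) v
        have h2 := hm.upperEnvelope_add_le (c • v) ((-c) • v)
        rw [← add_smul, add_neg_cancel, zero_smul, hm.upperEnvelope_zero] at h2
        linarith
      · simp [hm.upperEnvelope_zero]
      · exact (hm.upperEnvelope_smul hc v).ge)
  obtain ⟨μ, hμ, hrep, hμl⟩ := exists_isRepresenting_of_le_upperEnvelope hm l hl2
  refine ⟨μ, hμ, hrep, ?_⟩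
  rw [hμl]
  exact (hl1 ⟨v, Submodule.mem_span_singleton_self v⟩).trans
    (LinearPMap.mkSpanSingleton_apply ℝ ℝ hv _)

/-! ### Domination by a core measure -/

/-- The core condition for `σ = μ - m` yields a positive `ν = m - ε(μ - m)`. Thus `εμ ≤ (1 + ε)m`,
whence the constant `(1 + ε)/ε`. -/
theorem IsCoreMeasure.exists_integral_le {m : Measure X} [IsFiniteMeasure m]
    (hm : IsCoreMeasure φ m) {μ : Measure X} [IsFiniteMeasure μ] (hμ : IsRepresenting φ μ) :
    ∃ C : ℝ, 0 ≤ C ∧ ∀ v : C(X, ℝ), 0 ≤ v → integralCM μ v ≤ C * integralCM m v := by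
  obtain ⟨δ, hδ, h⟩ := hm.2.2 (μ.toSignedMeasure - m.toSignedMeasure)
    ⟨μ, inferInstance, hμ, by abel⟩
  obtain ⟨ν, hν, -, hνe⟩ := h (δ / 2) (by linarith) (by linarith)
  set ε : NNReal := ⟨δ / 2, by linarith⟩ with hε
  have hε0 : (0 : ℝ) < ε := by change 0 < δ / 2; linarith
  have hmeas : (1 + ε) • m = ν + ε • μ := by
    rw [← Measure.toSignedMeasure_eq_toSignedMeasure_iff, Measure.toSignedMeasure_add,
      Measure.toSignedMeasure_smul, Measure.toSignedMeasure_smul, ← hνe, add_smul, one_smul]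
    change m.toSignedMeasure + (δ / 2) • m.toSignedMeasure =
      m.toSignedMeasure - (δ / 2) • (μ.toSignedMeasure - m.toSignedMeasure) +
        (δ / 2) • μ.toSignedMeasure
    rw [smul_sub]
    abel
  refine ⟨(1 + ε) / ε, by positivity, fun v hv => ?_⟩
  have h1 : ∫ x, v x ∂((1 + ε) • m) = ∫ x, v x ∂(ν + ε • μ) := by rw [hmeas]
  rw [integral_add_measure (integrable_continuousMap _ v) (integrable_continuousMap _ v),
    integral_smul_nnreal_measure, integral_smul_nnreal_measure] at h1
  have h2 : 0 ≤ ∫ x, v x ∂ν := integral_nonneg hv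
  rw [div_mul_eq_mul_div, le_div_iff₀ hε0]
  simp only [NNReal.smul_def, smul_eq_mul, NNReal.coe_add, NNReal.coe_one] at h1
  simp only [integralCM_apply]
  linarith

/-- A basis of the span is chosen inside `S`; in finite dimension its coordinates are controlled by
the norm. -/
theorem exists_finset_bounded_coefficients {V : Type*} [NormedAddCommGroup V] [NormedSpace ℝ V]
    [FiniteDimensional ℝ V] {S : Set V} {R : ℝ} (hS : ∀ x ∈ S, ‖x‖ ≤ R) :
    ∃ (t : Finset V) (K : ℝ), (t : Set V) ⊆ S ∧
      ∀ x ∈ S, ∃ c : V → ℝ, (∀ y ∈ t, |c y| ≤ K) ∧ ∑ y ∈ t, c y • y = x := by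
  classical
  obtain ⟨b, hbS, hspan, hb⟩ := exists_linearIndependent ℝ S
  have hfin : b.Finite := hb.setFinite
  let t := hfin.toFinset
  have hspan' : ∀ x ∈ S, ∃ c : V → ℝ, ∑ y ∈ t, c y • y = x := fun x hx => by
    have : x ∈ Submodule.span ℝ (t : Set V) := by
      rw [hfin.coe_toFinset, hspan]
      exact Submodule.subset_span hx
    obtain ⟨c, -, hc⟩ := Submodule.mem_span_finset.1 this
    exact ⟨c, hc⟩
  let G : (t → ℝ) →ₗ[ℝ] V := Fintype.linearCombination ℝ (fun y : t => (y : V))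
  have hG : Function.Injective G := by
    have : LinearIndependent ℝ (fun y : t => (y : V)) := by
      have := hb.comp (fun y : t => (⟨y, hfin.mem_toFinset.1 y.2⟩ : b))
        fun y z h => Subtype.ext (congrArg (fun w : b => (w : V)) h)
      exact this
    exact this.fintypeLinearCombination_injective
  obtain ⟨K, hK, hanti⟩ := LinearMap.exists_antilipschitzWith G (LinearMap.ker_eq_bot.2 hG)
  refine ⟨t, K * R, by simpa [t] using hbS, fun x hx => ?_⟩
  obtain ⟨c, hc⟩ := hspan' x hx
  refine ⟨c, fun y hy => ?_, hc⟩
  have hGc : G (fun y => c y) = x := by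
    rw [← hc, Fintype.linearCombination_apply]
    exact Finset.sum_coe_sort t fun y => c y • y
  have h1 := hanti.le_mul_norm (map_zero G) (fun y => c y)
  rw [hGc] at h1
  calc |c y| = ‖(fun y : t => c y) ⟨y, hy⟩‖ := rfl
    _ ≤ ‖fun y : t => c y‖ := norm_le_pi_norm (fun y : t => c y) ⟨y, hy⟩
    _ ≤ K * ‖x‖ := h1
    _ ≤ K * R := mul_le_mul_of_nonneg_left (hS x hx) K.2

/-- All representing measures are dominated by a fixed multiple of a core measure. -/
theorem IsCoreMeasure.exists_uniform_integral_le (hA : IsHypoDirichlet A) {m : Measure X}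
    [IsFiniteMeasure m] (hm : IsCoreMeasure φ m) :
    ∃ C : ℝ, 0 ≤ C ∧ ∀ (μ : Measure X) [IsFiniteMeasure μ], IsRepresenting φ μ →
      ∀ v : C(X, ℝ), 0 ≤ v → integralCM μ v ≤ C * integralCM m v := by
  obtain ⟨-, s, f, hdense⟩ := hA
  have hbound : ∀ (μ : Measure X) [IsFiniteMeasure μ], IsRepresenting φ μ →
      ∀ g : C(X, ℝ), |integralCM μ g| ≤ ‖g‖ := fun μ _ hμ g => by
    have := hμ.isProbabilityMeasure
    simpa using norm_integral_le_of_norm_le_const (μ := μ)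
      (Filter.Eventually.of_forall g.norm_coe_le_norm)
  -- These finitely many numbers determine `μ`: representing measures agree on `Re A`, so `μ - m` is
  -- known on a dense subspace from its values on the `log |fᵢ|`.
  let e : (μ : Measure X) → [IsFiniteMeasure μ] → Fin s → ℝ := fun μ _ i =>
    integralCM μ (logAbs A (f i)) - integralCM m (logAbs A (f i))
  let S : Set (Fin s → ℝ) :=
    {y | ∃ (μ : Measure X) (_ : IsFiniteMeasure μ), IsRepresenting φ μ ∧ e μ = y}
  have hS : ∀ y ∈ S, ‖y‖ ≤ ∑ i, 2 * ‖logAbs A (f i)‖ := by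
    rintro _ ⟨μ, hμf, hμ, rfl⟩
    refine (pi_norm_le_iff_of_nonneg (by positivity)).2 fun i => ?_
    refine le_trans ?_ (Finset.single_le_sum (f := fun i => 2 * ‖logAbs A (f i)‖)
      (fun i _ => by positivity) (Finset.mem_univ i))
    rw [Real.norm_eq_abs]
    refine (abs_sub _ _).trans ?_
    linarith [hbound μ hμ (logAbs A (f i)), hbound m hm.1 (logAbs A (f i))]
  obtain ⟨t, K, htS, hK⟩ := exists_finset_bounded_coefficients hS
  choose! ν hνf hν using fun y (hy : y ∈ t) => htS hy
  have hC : ∀ y, ∃ C : ℝ, 0 ≤ C ∧ ∀ (hy : y ∈ t), ∀ v : C(X, ℝ), 0 ≤ v →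
      haveI := hνf y hy
      integralCM (ν y) v ≤ C * integralCM m v := fun y => by
    by_cases hy : y ∈ t
    · have := hνf y hy
      obtain ⟨C, h0, hC⟩ := hm.exists_integral_le (hν y hy).1
      exact ⟨C, h0, fun _ => hC⟩
    · exact ⟨0, le_rfl, fun h => absurd h hy⟩
  choose C hC0 hC using hC
  refine ⟨1 + ∑ y ∈ t, |K| * (C y + 1), ?_, fun μ _ hμ v hv => ?_⟩
  · have : 0 ≤ ∑ y ∈ t, |K| * (C y + 1) :=
      Finset.sum_nonneg fun y _ => mul_nonneg (abs_nonneg _) (by linarith [hC0 y])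
    linarith
  obtain ⟨c, hcK, hc⟩ := hK (e μ) ⟨μ, inferInstance, hμ, rfl⟩
  let I : (Fin s → ℝ) → C(X, ℝ) →L[ℝ] ℝ := fun y =>
    if hy : y ∈ t then haveI := hνf y hy; integralCM (ν y) else 0
  have hI : ∀ y (hy : y ∈ t), haveI := hνf y hy; I y = integralCM (ν y) := fun y hy => dif_pos hy
  have hident : integralCM μ - integralCM m - ∑ y ∈ t, c y • (I y - integralCM m) = 0 := by
    refine ContinuousLinearMap.ext_on hdense ?_
    rintro _ (⟨a, ha, rfl⟩ | ⟨i, rfl⟩)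
    · have hre : ∀ (κ : Measure X) [IsFiniteMeasure κ], IsRepresenting φ κ →
          integralCM κ (rePart a) = (φ ⟨a, ha⟩).re := fun κ _ hκ => hκ.integralCM_rePart ⟨a, ha⟩
      have h0 : ∀ y ∈ t, c y • (I y (rePart a) - integralCM m (rePart a)) = 0 := fun y hy => by
        have := hνf y hy
        rw [hI y hy, hre _ (hν y hy).1, hre m hm.1, sub_self, smul_zero]
      simp only [_root_.sub_apply, _root_.sum_apply, _root_.smul_apply, _root_.zero_apply]
      rw [Finset.sum_eq_zero h0, hre μ hμ, hre m hm.1, sub_self, sub_zero]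
    · have h1 := congrFun hc i
      simp only [_root_.sub_apply, _root_.sum_apply, _root_.smul_apply, _root_.zero_apply]
      rw [sub_eq_zero]
      change e μ i = _
      rw [← h1, Finset.sum_apply]
      refine Finset.sum_congr rfl fun y hy => ?_
      have := hνf y hy
      rw [hI y hy, Pi.smul_apply]
      congr 1
      exact (congrFun (hν y hy).2 i).symm
  have hv' := DFunLike.congr_fun hident v
  simp only [_root_.sub_apply, _root_.sum_apply, _root_.smul_apply, _root_.zero_apply,
    smul_eq_mul] at hv'
  have hm0 : 0 ≤ integralCM m v := integral_nonneg hv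
  have hterm : ∀ y ∈ t, c y * (I y v - integralCM m v) ≤
      |K| * (C y + 1) * integralCM m v := fun y hy => by
    have := hνf y hy
    have h1 : 0 ≤ I y v := by rw [hI y hy]; exact integral_nonneg hv
    have h2 : I y v ≤ C y * integralCM m v := by rw [hI y hy]; exact hC y hy v hv
    calc c y * (I y v - integralCM m v) ≤ |c y| * |I y v - integralCM m v| := by
          rw [← abs_mul]; exact le_abs_self _
      _ ≤ |K| * ((C y + 1) * integralCM m v) := by
          refine mul_le_mul ((hcK y hy).trans (le_abs_self K)) ?_ (abs_nonneg _) (abs_nonneg _)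
          rw [abs_le]
          constructor <;> nlinarith [hC0 y, mul_nonneg (hC0 y) hm0]
      _ = |K| * (C y + 1) * integralCM m v := by ring
  have hsum := Finset.sum_le_sum hterm
  rw [← Finset.sum_mul] at hsum
  linarith

theorem IsCoreMeasure.exists_rePart_ge [T2Space X] (hA : IsHypoDirichlet A) {m : Measure X}
    [IsFiniteMeasure m] (hm : IsCoreMeasure φ m) :
    ∃ C : ℝ, 0 ≤ C ∧ ∀ v : C(X, ℝ), 0 ≤ v → ∀ ε : ℝ, 0 < ε →
      ∃ a : A, v ≤ rePart a.1 ∧ (φ a).re < C * integralCM m v + ε := by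
  obtain ⟨C, hC0, hC⟩ := hm.exists_uniform_integral_le hA
  refine ⟨C, hC0, fun v hv ε hε => ?_⟩
  obtain ⟨μ, hμf, hμ, hμv⟩ := hm.1.exists_integral_eq_upperEnvelope v
  exact exists_lt_of_upperEnvelope_lt (by linarith [hC μ hμ v hv])

/-- `A` need not be closed nor `φ` assumed continuous, so `exp a` is replaced by a partial sum of
its series, good for the values on `X` and for `φ` at once. -/
theorem exists_mem_norm_sub_exp_lt (φ : A →ₐ[ℂ] ℂ) (a : A) {η : ℝ} (hη : 0 < η) :
    ∃ b : A, (∀ x, ‖b.1 x - Complex.exp (a.1 x)‖ < η) ∧ ‖φ b - Complex.exp (φ a)‖ < η := by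
  let s : ℕ → A := fun n => ∑ k ∈ Finset.range n, ((k.factorial : ℂ)⁻¹) • a ^ k
  have h1 : Filter.Tendsto (fun n => (s n).1) Filter.atTop (𝓝 (NormedSpace.exp a.1)) := by
    have := (NormedSpace.exp_series_hasSum_exp' (𝕂 := ℂ) a.1).tendsto_sum_nat
    convert this using 2 with n
    simp [s]
  have h2 : Filter.Tendsto (fun n => φ (s n)) Filter.atTop (𝓝 (NormedSpace.exp (φ a))) := by
    have := (NormedSpace.exp_series_hasSum_exp' (𝕂 := ℂ) (φ a)).tendsto_sum_nat
    convert this using 2 with n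
    change φ.toLinearMap (s n) = _
    rw [map_sum]
    refine Finset.sum_congr rfl fun k _ => ?_
    rw [LinearMap.map_smul]
    exact congrArg _ (map_pow φ a k)
  obtain ⟨n, hn1, hn2⟩ := ((Metric.tendsto_nhds.1 h1 η hη).and
    (Metric.tendsto_nhds.1 h2 η hη)).exists
  refine ⟨s n, fun x => ?_, ?_⟩
  · have h3 : NormedSpace.exp a.1 x = Complex.exp (a.1 x) := by
      have hcont : Continuous (ContinuousMap.evalAlgHom ℂ ℂ x : C(X, ℂ) →ₐ[ℂ] ℂ) :=
        continuous_eval_const x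
      rw [Complex.exp_eq_exp_ℂ]
      exact NormedSpace.map_exp (ContinuousMap.evalAlgHom ℂ ℂ x) hcont a.1
    rw [← h3, ← dist_eq_norm]
    exact (ContinuousMap.dist_apply_le_dist x).trans_lt hn1
  · rwa [Complex.exp_eq_exp_ℂ, ← dist_eq_norm]

/-- Take an approximation of `exp(-a)` where `Re a ≥ v`, rotated so that `φ` becomes real and scaled
down to absorb the approximation error. -/
theorem IsCoreMeasure.exists_norm_le_exp_neg [T2Space X] (hA : IsHypoDirichlet A) {m : Measure X}
    [IsFiniteMeasure m] (hm : IsCoreMeasure φ m) :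
    ∃ C : ℝ, 0 ≤ C ∧ ∀ v : C(X, ℝ), 0 ≤ v → ∀ ε : ℝ, 0 < ε →
      ∃ b : A, (∀ x, ‖b.1 x‖ ≤ Real.exp (-v x)) ∧
        ∃ r : ℝ, φ b = r ∧ Real.exp (-(C * integralCM m v + ε)) ≤ r := by
  obtain ⟨C, hC0, hC⟩ := hm.exists_rePart_ge hA
  refine ⟨C, hC0, fun v hv ε hε => ?_⟩
  obtain ⟨a, hva, ha⟩ := hC v hv (ε / 2) (by linarith)
  set P := C * integralCM m v
  have hcont : Filter.Tendsto
      (fun η : ℝ => (Real.exp (-(P + ε / 2)) - η) / (1 + η * Real.exp ‖v‖)) (𝓝 0)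
      (𝓝 ((Real.exp (-(P + ε / 2)) - 0) / (1 + 0 * Real.exp ‖v‖))) :=
    ContinuousAt.div (by fun_prop) (by fun_prop) (by simp)
  have hlt : Real.exp (-(P + ε)) < (Real.exp (-(P + ε / 2)) - 0) / (1 + 0 * Real.exp ‖v‖) := by
    simpa using hε
  obtain ⟨η, hη1, hη0⟩ := (((hcont.eventually (lt_mem_nhds hlt)).filter_mono
    (nhdsWithin_le_nhds (s := Set.Ioi 0))).and self_mem_nhdsWithin).exists
  replace hη0 : 0 < η := hη0
  obtain ⟨b, hb, hφb⟩ := exists_mem_norm_sub_exp_lt φ (-a) hη0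
  -- As `exp(-v) ≥ exp(-‖v‖)`, an error `η` costs at most the factor `D`; the spare `ε / 2` pays for
  -- this factor and for the error in `φ`.
  set D := 1 + η * Real.exp ‖v‖
  have hD : 0 < D := by positivity
  set u : ℂ := conj (φ b) / ‖φ b‖ / D
  have hu : ‖u‖ ≤ 1 / D := by
    simp only [u, norm_div, RCLike.norm_conj, Complex.norm_real, norm_norm, Real.norm_of_nonneg hD.le]
    gcongr
    exact div_self_le_one _
  refine ⟨u • b, fun x => ?_, ‖φ b‖ / D, ?_, hη1.le.trans ?_⟩
  · have h1 : ‖b.1 x‖ ≤ Real.exp (-v x) + η := by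
      have h2 := norm_le_norm_add_norm_sub' (b.1 x) (Complex.exp ((-a).1 x))
      have h3 : ‖Complex.exp ((-a).1 x)‖ ≤ Real.exp (-v x) := by
        rw [Complex.norm_exp, Real.exp_le_exp]
        have h4 : v x ≤ (a.1 x).re := hva x
        simpa using h4
      linarith [hb x]
    have h4 : η ≤ η * Real.exp ‖v‖ * Real.exp (-v x) := by
      rw [mul_assoc, ← Real.exp_add]
      refine le_mul_of_one_le_right hη0.le (Real.one_le_exp ?_)
      have := (le_abs_self _).trans (v.norm_coe_le_norm x)
      linarith
    calc ‖(u • b).1 x‖ = ‖u‖ * ‖b.1 x‖ := norm_mul _ _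
      _ ≤ 1 / D * (D * Real.exp (-v x)) := by
        refine mul_le_mul hu ?_ (norm_nonneg _) (by positivity)
        rw [add_mul, one_mul]
        linarith
      _ = Real.exp (-v x) := by field_simp
  · rw [functional_smul]
    have h5 : conj (φ b) / ‖φ b‖ * φ b = ‖φ b‖ := by
      rcases eq_or_ne (φ b) 0 with h | h
      · simp [h]
      · rw [div_mul_eq_mul_div, Complex.conj_mul', sq,
          mul_div_assoc, div_self (by simpa using h), mul_one]
    rw [div_mul_eq_mul_div, h5, Complex.ofReal_div]
  · gcongr
    have h6 : ‖Complex.exp (φ (-a))‖ ≥ Real.exp (-(P + ε / 2)) := by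
      rw [Complex.norm_exp, map_neg]
      refine Real.exp_le_exp.2 ?_
      rw [Complex.neg_re]
      linarith
    have h7 := norm_le_norm_add_norm_sub (φ b) (Complex.exp (φ (-a)))
    linarith

end RepresentingMeasures

end HypoDirichlet
namespace HypoDirichlet

/-! ### Bounded multipliers for elements of `H²(m)`. -/

section Hardy

variable {X : Type*} [TopologicalSpace X] [CompactSpace X] [MeasurableSpace X] [BorelSpace X]
  {A : Subalgebra ℂ C(X, ℂ)} {φ : A →ₐ[ℂ] ℂ} {m : Measure X} [IsFiniteMeasure m]

theorem continuous_weakStar_integral_mul {k : X → ℂ} (hk : MemLp k 1 m) :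
    @Continuous _ _ (weakStarTopology m) _ (fun h : Lp ℂ ∞ m => ∫ x, h x * k x ∂m) := by
  have h1 : (fun h : Lp ℂ ∞ m => ∫ x, h x * k x ∂m) =
      fun h : Lp ℂ ∞ m => ∫ x, h x * hk.toLp k x ∂m := by
    ext h
    refine integral_congr_ae ?_
    filter_upwards [hk.coeFn_toLp] with x hx
    rw [hx]
  rw [h1]
  exact @Continuous.comp _ _ _ (weakStarTopology m) _ _ _
    (fun p : Lp ℂ 1 m → ℂ => p (hk.toLp k)) (continuous_apply _) continuous_induced_dom

/-- By dominated convergence against each `L¹` function, bounded pointwise limits are weak-star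
limits. -/
theorem exists_mem_Hinf_of_tendsto {a : ℕ → A} (hbound : ∀ n x, ‖(a n).1 x‖ ≤ 1) {g : X → ℂ}
    (hlim : ∀ᵐ x ∂m, Filter.Tendsto (fun n => (a n).1 x) Filter.atTop (𝓝 (g x))) :
    ∃ h : Hinf A m, h.1 =ᵐ[m] g := by
  have hmeas : AEStronglyMeasurable g m := aestronglyMeasurable_of_tendsto_ae Filter.atTop
    (fun n => (a n).1.continuous.aestronglyMeasurable) hlim
  have hg : MemLp g ∞ m := memLp_top_of_bound hmeas 1 (by
    filter_upwards [hlim] with x hx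
    exact le_of_tendsto hx.norm (Filter.Eventually.of_forall fun n => hbound n x))
  refine ⟨⟨hg.toLp g, ?_⟩, hg.coeFn_toLp⟩
  refine @mem_closure_of_tendsto (Lp ℂ ∞ m) (weakStarTopology m) _ _ _
    (fun n => ContinuousMap.toLp (E := ℂ) ∞ m ℂ (a n).1) Filter.atTop _ ?_
    (Filter.Eventually.of_forall fun n => ⟨_, (a n).2, rfl⟩)
  rw [nhds_induced, Filter.tendsto_comap_iff, tendsto_pi_nhds]
  intro k
  have hk : Integrable k m := L1.integrable_coeFn k
  refine tendsto_integral_of_dominated_convergence (fun x => ‖k x‖) (fun n => ?_) hk.norm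
    (fun n => ?_) ?_
  · exact (Lp.aestronglyMeasurable _).mul hk.1
  · filter_upwards [ContinuousMap.coeFn_toLp (p := ∞) (𝕜 := ℂ) m (a n).1] with x hx
    rw [hx, norm_mul]
    exact mul_le_of_le_one_left (norm_nonneg _) (hbound n x)
  · have hall : ∀ᵐ x ∂m, ∀ n, ContinuousMap.toLp (E := ℂ) ∞ m ℂ (a n).1 x = (a n).1 x :=
      ae_all_iff.2 fun n => ContinuousMap.coeFn_toLp (p := ∞) (𝕜 := ℂ) m (a n).1
    filter_upwards [hlim, hall, hg.coeFn_toLp] with x h1 h2 h3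
    simp only [h2, h3]
    exact h1.mul_const _

theorem norm_toLp_two_sq (a : C(X, ℂ)) :
    ‖ContinuousMap.toLp (E := ℂ) 2 m ℂ a‖ ^ 2 = ∫ x, ‖a x‖ ^ 2 ∂m := by
  have h := inner_self_eq_norm_sq_to_K (𝕜 := ℂ) (ContinuousMap.toLp (E := ℂ) 2 m ℂ a)
  rw [L2.inner_def] at h
  have h2 : ∫ x, inner ℂ (ContinuousMap.toLp (E := ℂ) 2 m ℂ a x)
      (ContinuousMap.toLp (E := ℂ) 2 m ℂ a x) ∂m = ∫ x, ((‖a x‖ ^ 2 : ℝ) : ℂ) ∂m := by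
    refine integral_congr_ae ?_
    filter_upwards [ContinuousMap.coeFn_toLp (p := 2) (𝕜 := ℂ) m a] with x hx
    rw [hx, inner_self_eq_norm_sq_to_K]
    simp
  rw [h2, integral_complex_ofReal] at h
  refine Complex.ofReal_injective ?_
  rw [Complex.ofReal_pow]
  exact h.symm

/-- The variance of `|a|` is nonnegative. -/
theorem integral_norm_le_norm_toLp_two [IsProbabilityMeasure m] (a : C(X, ℂ)) :
    ∫ x, ‖a x‖ ∂m ≤ ‖ContinuousMap.toLp (E := ℂ) 2 m ℂ a‖ := by
  have h1 : 0 ≤ ∫ x, (‖a x‖ - ∫ y, ‖a y‖ ∂m) ^ 2 ∂m := integral_nonneg fun x => sq_nonneg _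
  set I := ∫ y, ‖a y‖ ∂m
  have hi : Integrable (fun x => ‖a x‖) m := (integrable_continuousMap m a).norm
  have hi2 : Integrable (fun x => ‖a x‖ ^ 2) m :=
    integrable_continuousMap m (⟨fun x => ‖a x‖ ^ 2, by fun_prop⟩ : C(X, ℝ))
  have h2 : ∫ x, (‖a x‖ - I) ^ 2 ∂m = ∫ x, ‖a x‖ ^ 2 ∂m - 2 * I * I + I ^ 2 := by
    have : ∀ x, (‖a x‖ - I) ^ 2 = ‖a x‖ ^ 2 - 2 * I * ‖a x‖ + I ^ 2 := fun x => by ring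
    simp only [this]
    have hi3 : Integrable (fun x => ‖a x‖ ^ 2 - 2 * I * ‖a x‖) m := hi2.sub (hi.const_mul _)
    rw [integral_add hi3 (integrable_const _), integral_sub hi2 (hi.const_mul _),
      integral_const_mul]
    simp [I]
  rw [h2, ← norm_toLp_two_sq] at h1
  exact abs_le_of_sq_le_sq' (by linarith) (norm_nonneg _) |>.2

/-- `log (1 + |a|)` -/
noncomputable def logOneAddNorm (a : C(X, ℂ)) : C(X, ℝ) where
  toFun x := Real.log (1 + ‖a x‖)
  continuous_toFun := Continuous.log (by fun_prop) fun x => by positivity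

theorem logOneAddNorm_nonneg (a : C(X, ℂ)) : 0 ≤ logOneAddNorm a := fun x =>
  Real.log_nonneg (by simp)

theorem exp_neg_logOneAddNorm (a : C(X, ℂ)) (x : X) :
    Real.exp (-logOneAddNorm a x) = (1 + ‖a x‖)⁻¹ := by
  have h : 0 < 1 + ‖a x‖ := by positivity
  change Real.exp (-Real.log (1 + ‖a x‖)) = _
  rw [Real.exp_neg, Real.exp_log h]

theorem integralCM_logOneAddNorm_le [IsProbabilityMeasure m] (a : C(X, ℂ)) :
    integralCM m (logOneAddNorm a) ≤ ‖ContinuousMap.toLp (E := ℂ) 2 m ℂ a‖ := by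
  refine le_trans ?_ (integral_norm_le_norm_toLp_two a)
  refine integral_mono (integrable_continuousMap m _) (integrable_continuousMap m a).norm
    fun x => ?_
  have h : 0 < 1 + ‖a x‖ := by positivity
  have := Real.log_le_sub_one_of_pos h
  change Real.log (1 + ‖a x‖) ≤ ‖a x‖
  linarith

/-- Every element of `H²(m)` is the limit of a series of elements of `A` whose norms decrease
geometrically. -/
theorem exists_geometric_series (f : H2 A m) :
    ∃ (d : ℕ → A) (K : ℝ), 0 ≤ K ∧
      (∀ n, ‖ContinuousMap.toLp (E := ℂ) 2 m ℂ (d n).1‖ ≤ K * (1 / 4) ^ n) ∧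
      Filter.Tendsto (fun n => ContinuousMap.toLp (E := ℂ) 2 m ℂ
        (∑ k ∈ Finset.range (n + 1), d k : A).1) Filter.atTop (𝓝 f.1) := by
  set J := ContinuousMap.toLp (E := ℂ) 2 m ℂ
  have happ : ∀ n : ℕ, ∃ a : A, ‖J a.1 - f.1‖ < (1 / 4) ^ n := fun n => by
    obtain ⟨_, ⟨a, ha, rfl⟩, h⟩ := Metric.mem_closure_iff.1 f.2 ((1 / 4) ^ n) (by positivity)
    refine ⟨⟨a, ha⟩, ?_⟩
    rwa [dist_comm, dist_eq_norm] at h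
  choose a ha using happ
  let d : ℕ → A := fun n => Nat.casesOn n (a 0) fun k => a (k + 1) - a k
  have hsum : ∀ n, ∑ k ∈ Finset.range (n + 1), d k = a n := fun n => by
    induction n with
    | zero => simp [d]
    | succ n ih =>
      rw [Finset.sum_range_succ, ih]
      exact add_sub_cancel _ _
  -- Consecutive approximants differ by at most `4⁻ⁿ + 4⁻ⁿ⁻¹ = 5 · 4⁻ⁿ⁻¹`; the first has norm at
  -- most `‖f‖ + 1`.
  refine ⟨d, ‖f.1‖ + 5, by positivity, fun n => ?_, ?_⟩
  · cases n with
    | zero =>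
      have h1 := norm_le_norm_add_norm_sub (f.1) (J (a 0).1)
      have h2 := ha 0
      have h3 := norm_le_norm_add_norm_sub' (J (a 0).1) f.1
      change ‖J (a 0).1‖ ≤ _
      simp only [pow_zero, mul_one] at h2 ⊢
      linarith
    | succ n =>
      have h1 : J (d (n + 1)).1 = (J (a (n + 1)).1 - f.1) - (J (a n).1 - f.1) := by
        rw [sub_sub_sub_cancel_right, ← map_sub]
        rfl
      rw [h1]
      refine (norm_sub_le _ _).trans ?_
      have h2 := ha n
      have h3 := ha (n + 1)
      have h4 : (0 : ℝ) < (1 / 4) ^ n := by positivity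
      rw [pow_succ] at h3 ⊢
      nlinarith [norm_nonneg f.1]
  · simp only [hsum]
    rw [tendsto_iff_norm_sub_tendsto_zero]
    exact squeeze_zero (fun _ => norm_nonneg _) (fun n => (ha n).le)
      (tendsto_pow_atTop_nhds_zero_of_lt_one (by norm_num) (by norm_num))

theorem norm_sum_le_prod_one_add_norm {E : Type*} [SeminormedAddCommGroup E] (d : ℕ → E) (n : ℕ) :
    ‖∑ k ∈ Finset.range n, d k‖ ≤ ∏ k ∈ Finset.range n, (1 + ‖d k‖) := by
  have h : 1 + ∑ k ∈ Finset.range n, ‖d k‖ ≤ ∏ k ∈ Finset.range n, (1 + ‖d k‖) := by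
      induction n with
      | zero => simp
      | succ n ih =>
        rw [Finset.sum_range_succ, Finset.prod_range_succ, ← add_assoc]
        nlinarith [norm_nonneg (d n), Finset.sum_nonneg fun k (_ : k ∈ Finset.range n) =>
          norm_nonneg (d k)]
  linarith [norm_sum_le (Finset.range n) d]

theorem norm_sub_one_sq_le {z : ℂ} (hz : ‖z‖ ≤ 1) : ‖z - 1‖ ^ 2 ≤ 2 - 2 * z.re := by
  rw [Complex.sq_norm, Complex.normSq_apply]
  have h : z.re * z.re + z.im * z.im ≤ 1 := by
    rw [← Complex.normSq_apply, ← Complex.sq_norm]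
    exact pow_le_one₀ (norm_nonneg _) hz
  simp only [Complex.sub_re, Complex.one_re, Complex.sub_im, Complex.one_im]
  nlinarith

/-- Multiplying a bounded element of `A` by a contractive element of `A` with value near `1`
moves it little in `L²(m)`. -/
theorem IsRepresenting.norm_toLp_mul_sub_le [IsProbabilityMeasure m] (hm : IsRepresenting φ m)
    {B b : A} (hB : ∀ x, ‖B.1 x‖ ≤ 1) (hb : ∀ x, ‖b.1 x‖ ≤ 1) :
    ‖ContinuousMap.toLp (E := ℂ) 2 m ℂ ((B * b).1 - B.1)‖ ^ 2 ≤ 2 - 2 * (φ b).re := by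
  rw [norm_toLp_two_sq, ← hm.integralCM_rePart b]
  have hi : Integrable (fun x => (b.1 x).re) m := integrable_continuousMap m (rePart b.1)
  have h1 : ∫ x, (2 - 2 * (b.1 x).re) ∂m = 2 - 2 * integralCM m (rePart b.1) := by
    rw [integral_sub (integrable_const _) (hi.const_mul _), integral_const_mul]
    simp [rePart]
  rw [← h1]
  refine integral_mono (integrable_continuousMap m
    (⟨fun x => ‖((B * b).1 - B.1) x‖ ^ 2, by fun_prop⟩ : C(X, ℝ)))
    ((integrable_const _).sub (hi.const_mul _)) fun x => ?_
  refine le_trans ?_ (norm_sub_one_sq_le (hb x))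
  have h2 : ((B * b).1 - B.1) x = B.1 x * (b.1 x - 1) := by
    change B.1 x * b.1 x - B.1 x = _
    ring
  change ‖((B * b).1 - B.1) x‖ ^ 2 ≤ _
  rw [h2, norm_mul, mul_pow]
  exact mul_le_of_le_one_left (sq_nonneg _) (pow_le_one₀ (norm_nonneg _) (hB x))

theorem exists_common_ae_subsequence {f g : ℕ → Lp ℂ 2 m} {f' g' : Lp ℂ 2 m}
    (hf : Filter.Tendsto f Filter.atTop (𝓝 f')) (hg : Filter.Tendsto g Filter.atTop (𝓝 g')) :
    ∃ ns : ℕ → ℕ,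
      (∀ᵐ x ∂m, Filter.Tendsto (fun i => f (ns i) x) Filter.atTop (𝓝 (f' x))) ∧
      ∀ᵐ x ∂m, Filter.Tendsto (fun i => g (ns i) x) Filter.atTop (𝓝 (g' x)) := by
  obtain ⟨ns, hns, h1⟩ := (tendstoInMeasure_of_tendsto_Lp hf).exists_seq_tendsto_ae
  obtain ⟨ms, hms, h2⟩ := (tendstoInMeasure_of_tendsto_Lp
    (hg.comp hns.tendsto_atTop)).exists_seq_tendsto_ae
  refine ⟨ns ∘ ms, ?_, h2⟩
  filter_upwards [h1] with x hx
  exact hx.comp hms.tendsto_atTop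

/-- Every element of `H²(m)` is multiplied into `H^∞(m)` by some element of `H^∞(m)` with
nonzero integral. -/
theorem IsCoreMeasure.exists_bounded_multiplier [T2Space X] (hA : IsHypoDirichlet A)
    (hm : IsCoreMeasure φ m) (f : H2 A m) :
    ∃ b g : Hinf A m, (g.1 =ᵐ[m] fun x => b.1 x * f.1 x) ∧ ∫ x, b.1 x ∂m ≠ 0 := by
  have := hm.1.isProbabilityMeasure
  obtain ⟨C, hC0, hC⟩ := hm.exists_norm_le_exp_neg hA
  obtain ⟨d, K, hK0, hd, hlim⟩ := exists_geometric_series f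
  set J := ContinuousMap.toLp (E := ℂ) 2 m ℂ with hJ
  choose β hβ r hr hrle using fun n => hC (logOneAddNorm (d n).1) (logOneAddNorm_nonneg _)
    ((1 / 4) ^ n) (by positivity)
  set K' := C * K + 1
  have hK' : 0 ≤ K' := by positivity
  have hrle' : ∀ n, Real.exp (-(K' * (1 / 4) ^ n)) ≤ r n := fun n => by
    refine le_trans (Real.exp_le_exp.2 (neg_le_neg ?_)) (hrle n)
    have := mul_le_mul_of_nonneg_left
      ((integralCM_logOneAddNorm_le (m := m) (d n).1).trans (hd n)) hC0
    rw [add_mul, one_mul]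
    linarith
  have hβ' : ∀ n x, ‖(β n).1 x‖ ≤ (1 + ‖(d n).1 x‖)⁻¹ := fun n x => by
    rw [← exp_neg_logOneAddNorm]
    exact hβ n x
  have hβ1 : ∀ n x, ‖(β n).1 x‖ ≤ 1 := fun n x =>
    (hβ' n x).trans (inv_le_one_of_one_le₀ (by simp))
  let B : ℕ → A := fun n => ∏ k ∈ Finset.range n, β k
  have hBapply : ∀ n x, (B n).1 x = ∏ k ∈ Finset.range n, (β k).1 x := fun n x => by
    induction n with
    | zero => rfl
    | succ n ih =>
      rw [Finset.prod_range_succ, ← ih]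
      exact congrArg (fun c : A => c.1 x) (Finset.prod_range_succ _ _)
  have hBprod : ∀ n x, ‖(B n).1 x‖ ≤ (∏ k ∈ Finset.range n, (1 + ‖(d k).1 x‖))⁻¹ := fun n x => by
    rw [hBapply, norm_prod, ← Finset.prod_inv_distrib]
    exact Finset.prod_le_prod (fun _ _ => norm_nonneg _) fun k _ => hβ' k x
  have hB1 : ∀ n x, ‖(B n).1 x‖ ≤ 1 := fun n x => by
    rw [hBapply, norm_prod]
    exact Finset.prod_le_one (fun _ _ => norm_nonneg _) fun k _ => hβ1 k x
  let a : ℕ → A := fun n => ∑ k ∈ Finset.range (n + 1), d k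
  have ha : ∀ n x, (a n).1 x = ∑ k ∈ Finset.range (n + 1), (d k).1 x := fun n x => by
    simp [a]
  -- The factors `1 + |d k|` bounding the partial sum are exactly those that the product divides
  -- out; `a n` has `n + 1` terms, hence the shift in `B`.
  have hBa : ∀ n x, ‖(B (n + 1) * a n).1 x‖ ≤ 1 := fun n x => by
    have hpos : 0 < ∏ k ∈ Finset.range (n + 1), (1 + ‖(d k).1 x‖) :=
      Finset.prod_pos fun k _ => by positivity
    calc ‖(B (n + 1) * a n).1 x‖ = ‖(B (n + 1)).1 x‖ * ‖(a n).1 x‖ := norm_mul _ _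
      _ ≤ (∏ k ∈ Finset.range (n + 1), (1 + ‖(d k).1 x‖))⁻¹ *
          ∏ k ∈ Finset.range (n + 1), (1 + ‖(d k).1 x‖) := by
        refine mul_le_mul (hBprod _ x) ?_ (norm_nonneg _) (inv_nonneg.2 hpos.le)
        rw [ha]
        exact norm_sum_le_prod_one_add_norm _ _
      _ = 1 := inv_mul_cancel₀ hpos.ne'
  have hφB : ∀ n, Real.exp (-(K' * 2)) ≤ (φ (B n)).re := fun n => by
    have h1 : φ (B n) = ((∏ k ∈ Finset.range n, r k : ℝ) : ℂ) := by
      rw [map_prod, Complex.ofReal_prod]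
      exact Finset.prod_congr rfl fun k _ => hr k
    have h2 : ∑ k ∈ Finset.range n, (1 / 4 : ℝ) ^ k ≤ 2 := by
      rw [geom_sum_eq (by norm_num)]
      have : (0 : ℝ) < (1 / 4) ^ n := by positivity
      rw [div_le_iff_of_neg (by norm_num)]
      linarith
    rw [h1, Complex.ofReal_re]
    calc Real.exp (-(K' * 2)) ≤ Real.exp (∑ k ∈ Finset.range n, -(K' * (1 / 4) ^ k)) := by
          rw [Finset.sum_neg_distrib, ← Finset.mul_sum]
          exact Real.exp_le_exp.2 (neg_le_neg (mul_le_mul_of_nonneg_left h2 hK'))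
      _ = ∏ k ∈ Finset.range n, Real.exp (-(K' * (1 / 4) ^ k)) := Real.exp_sum _ _
      _ ≤ ∏ k ∈ Finset.range n, r k :=
        Finset.prod_le_prod (fun _ _ => (Real.exp_pos _).le) fun k _ => hrle' k
  -- Since `1 - r n ≤ K' 4⁻ⁿ`, the squared step is at most `2 K' 4⁻ⁿ`; the square root gives ratio
  -- `1/2`.
  have hcauchy : CauchySeq fun n => J (B n).1 := by
    refine cauchySeq_of_le_geometric (1 / 2) (Real.sqrt (2 * K')) (by norm_num) fun n => ?_
    rw [dist_comm, dist_eq_norm, ← map_sub]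
    have h1 : B (n + 1) = B n * β n := Finset.prod_range_succ _ _
    rw [h1]
    refine abs_le_of_sq_le_sq' ?_ (by positivity) |>.2
    refine (hm.1.norm_toLp_mul_sub_le (hB1 n) (hβ1 n)).trans ?_
    rw [mul_pow, Real.sq_sqrt (by positivity), hr, Complex.ofReal_re, ← pow_mul, mul_comm n 2,
      pow_mul]
    have h2 := Real.add_one_le_exp (-(K' * (1 / 4) ^ n))
    have h3 := hrle' n
    norm_num at h2 h3 ⊢
    linarith
  obtain ⟨b₂, hb₂⟩ := cauchySeq_tendsto_of_complete hcauchy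
  obtain ⟨ns, hns1, hns2⟩ := exists_common_ae_subsequence
    (hb₂.comp (Filter.tendsto_add_atTop_nat 1)) hlim
  have hJall : ∀ c : ℕ → A, ∀ᵐ x ∂m, ∀ n, J (c n).1 x = (c n).1 x := fun c =>
    ae_all_iff.2 fun n => ContinuousMap.coeFn_toLp (p := 2) (𝕜 := ℂ) m (c n).1
  have hBlim : ∀ᵐ x ∂m, Filter.Tendsto (fun i => (B (ns i + 1)).1 x) Filter.atTop (𝓝 (b₂ x)) := by
    filter_upwards [hns1, hJall B] with x h1 h2
    simpa only [Function.comp_apply, h2] using h1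
  have halim : ∀ᵐ x ∂m, Filter.Tendsto (fun i => (a (ns i)).1 x) Filter.atTop (𝓝 (f.1 x)) := by
    filter_upwards [hns2, hJall a] with x h1 h2
    refine h1.congr fun i => h2 (ns i)
  obtain ⟨b, hb⟩ := exists_mem_Hinf_of_tendsto (fun i => hB1 (ns i + 1)) hBlim
  obtain ⟨g, hg⟩ := exists_mem_Hinf_of_tendsto (a := fun i => B (ns i + 1) * a (ns i))
    (g := fun x => b₂ x * f.1 x) (fun i => hBa (ns i)) (by
      filter_upwards [hBlim, halim] with x h1 h2
      exact h1.mul h2)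
  refine ⟨b, g, ?_, fun h0 => ?_⟩
  · filter_upwards [hb, hg] with x h1 h2
    rw [h1, h2]
  -- The integrals of the partial products are values of `φ` with real part at least `exp(-2K')`,
  -- and this survives in the limit.
  · have h1 : Filter.Tendsto (fun i => ∫ x, (B (ns i + 1)).1 x ∂m) Filter.atTop
        (𝓝 (∫ x, b₂ x ∂m)) :=
      tendsto_integral_of_dominated_convergence (fun _ => 1)
        (fun n => (B (ns n + 1)).1.continuous.aestronglyMeasurable) (integrable_const _)
        (fun n => Filter.Eventually.of_forall fun x => hB1 _ x) hBlim
    rw [← integral_congr_ae hb, h0] at h1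
    have h2 := ge_of_tendsto ((Complex.continuous_re.tendsto _).comp h1)
      (Filter.Eventually.of_forall fun i => show Real.exp (-(K' * 2)) ≤ _ by
        rw [Function.comp_apply, ← hm.1.2]
        exact hφB _)
    exact absurd h2 (by simp [Real.exp_pos])

end Hardy

end HypoDirichlet
namespace HypoDirichlet

/-! ### Multiplicativity of the integral and commuting transformations. -/

section Multiplicativity

variable {X : Type*} [TopologicalSpace X] [CompactSpace X] [MeasurableSpace X] [BorelSpace X]
  {A : Subalgebra ℂ C(X, ℂ)} {φ : A →ₐ[ℂ] ℂ} {m : Measure X} [IsFiniteMeasure m]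

theorem memLp_one_of_two (f : Lp ℂ 2 m) : MemLp f 1 m :=
  (Lp.memLp f).mono_exponent (by norm_num)

theorem coeFn_mulH2 (h : Hinf A m) (f : H2 A m) :
    (mulH2 A m h f).1 =ᵐ[m] fun x => h.1 x * f.1 x :=
  coeFn_mulL2 m h.1 f.1

variable (A m) in
/-- The integral, as a continuous functional on `H²(m)`. -/
noncomputable def integralH2 : H2 A m →L[ℂ] ℂ :=
  (innerSL ℂ (ContinuousMap.toLp (E := ℂ) 2 m ℂ 1)).comp (H2 A m).subtypeL

theorem integralH2_apply (f : H2 A m) : integralH2 A m f = ∫ x, f.1 x ∂m := by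
  change inner ℂ (ContinuousMap.toLp (E := ℂ) 2 m ℂ 1) f.1 = _
  rw [L2.inner_def]
  refine integral_congr_ae ?_
  filter_upwards [ContinuousMap.coeFn_toLp (p := 2) (𝕜 := ℂ) m (1 : C(X, ℂ))] with x hx
  rw [hx]
  simp

theorem toLp_mem_Hinf (a : A) : ContinuousMap.toLp (E := ℂ) ∞ m ℂ a.1 ∈ Hinf A m :=
  @subset_closure _ (weakStarTopology m) _ _ ⟨_, a.2, rfl⟩

theorem IsRepresenting.integralH2_toH2 (hm : IsRepresenting φ m) (a : A) :
    integralH2 A m (toH2 A m a) = φ a := by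
  rw [integralH2_apply, hm.2]
  exact integral_congr_ae (ContinuousMap.coeFn_toLp (p := 2) (𝕜 := ℂ) m a.1)

theorem denseRange_toH2 : DenseRange (toH2 A m) := by
  intro f
  rw [Metric.mem_closure_iff]
  intro ε hε
  obtain ⟨_, ⟨a, ha, rfl⟩, h⟩ := Metric.mem_closure_iff.1 f.2 ε hε
  exact ⟨_, ⟨⟨a, ha⟩, rfl⟩, h⟩

theorem IsRepresenting.integral_mul_H2 (hm : IsRepresenting φ m) (a : A) (f : H2 A m) :
    ∫ x, a.1 x * f.1 x ∂m = φ a * ∫ x, f.1 x ∂m := by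
  set h : Hinf A m := ⟨_, toLp_mem_Hinf a⟩ with hh
  have hh' : h.1 =ᵐ[m] a.1 := ContinuousMap.coeFn_toLp (p := ∞) (𝕜 := ℂ) m a.1
  have key : integralH2 A m (mulH2 A m h f) = φ a * integralH2 A m f := by
    refine congrFun (denseRange_toH2.equalizer
      (g := fun f => integralH2 A m (mulH2 A m h f)) (h := fun f => φ a * integralH2 A m f)
      (by fun_prop) (by fun_prop) (funext fun c => ?_)) f
    have h1 : mulH2 A m h (toH2 A m c) = toH2 A m (a * c) := by
      refine Subtype.ext (Lp.ext ?_)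
      filter_upwards [coeFn_mulH2 h (toH2 A m c), hh',
        ContinuousMap.coeFn_toLp (p := 2) (𝕜 := ℂ) m c.1,
        ContinuousMap.coeFn_toLp (p := 2) (𝕜 := ℂ) m (a * c).1] with x h1 h2 h3 h4
      rw [h1, h2]
      exact (congrArg _ h3).trans h4.symm
    simp only [Function.comp_apply]
    rw [h1, hm.integralH2_toH2, hm.integralH2_toH2]
    exact map_mul φ a c
  rw [integralH2_apply, integralH2_apply] at key
  rw [← key]
  refine integral_congr_ae ?_
  filter_upwards [coeFn_mulH2 h f, hh'] with x h1 h2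
  rw [h1, h2]

/-- The integral is multiplicative on `H^∞(m) × H²(m)`. -/
theorem IsRepresenting.integralH2_mulH2 (hm : IsRepresenting φ m) (h : Hinf A m) (f : H2 A m) :
    integralH2 A m (mulH2 A m h f) = (∫ x, h.1 x ∂m) * integralH2 A m f := by
  have hc1 := continuous_weakStar_integral_mul (m := m) (memLp_one_of_two f.1)
  have hc2 := continuous_weakStar_integral_mul (m := m) (memLp_const (1 : ℂ))
  have hclosed : @IsClosed _ (weakStarTopology m) {h : Lp ℂ ∞ m |
      ∫ x, h x * f.1 x ∂m = (∫ x, h x * 1 ∂m) * ∫ x, f.1 x ∂m} :=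
    @isClosed_eq _ _ _ (weakStarTopology m) _ _ _ hc1
      (@Continuous.mul _ _ _ _ _ (weakStarTopology m) _ _ hc2
        (@continuous_const _ _ (weakStarTopology m) _ _))
  have key : h.1 ∈ {h : Lp ℂ ∞ m |
      ∫ x, h x * f.1 x ∂m = (∫ x, h x * 1 ∂m) * ∫ x, f.1 x ∂m} := by
    refine (@IsClosed.closure_subset_iff _ (weakStarTopology m) _ _ hclosed).2 ?_ h.2
    rintro _ ⟨a, ha, rfl⟩
    have hae := ContinuousMap.coeFn_toLp (p := ∞) (𝕜 := ℂ) m a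
    have h1 := hm.integral_mul_H2 ⟨a, ha⟩ f
    rw [hm.2] at h1
    simp only [Set.mem_ofPred_eq, mul_one]
    rw [integral_congr_ae hae, ← h1]
    refine integral_congr_ae ?_
    filter_upwards [hae] with x hx
    rw [hx]
  simp only [Set.mem_ofPred_eq, mul_one] at key
  rw [integralH2_apply, integralH2_apply, ← key]
  exact integral_congr_ae (coeFn_mulH2 h f)

/-- With multipliers `b` for `f` and `d` for `g`, the vector `b f d g` of `D` is an `H^∞(m)`
multiple of `g` and also of `f`. Applying `L` both ways and integrating leaves the common factor `∫b
∫d ≠ 0` to cancel. -/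
theorem IsCoreMeasure.integralH2_mul_comm [T2Space X] (hA : IsHypoDirichlet A)
    (hm : IsCoreMeasure φ m) {D : Submodule ℂ (H2 A m)} {L : D →ₗ[ℂ] H2 A m}
    (hD : ∀ h : Hinf A m, ∀ f ∈ D, mulH2 A m h f ∈ D)
    (hL : ∀ (h : Hinf A m) (f : D), L ⟨mulH2 A m h f, hD h f f.2⟩ = mulH2 A m h (L f)) (f g : D) :
    integralH2 A m f * integralH2 A m (L g) = integralH2 A m g * integralH2 A m (L f) := by
  obtain ⟨b, bf, hbf, hb0⟩ := hm.exists_bounded_multiplier hA f.1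
  obtain ⟨d, dg, hdg, hd0⟩ := hm.exists_bounded_multiplier hA g.1
  have hint : ∀ {b bf : Hinf A m} {f : H2 A m}, (bf.1 =ᵐ[m] fun x => b.1 x * f.1 x) →
      ∫ x, bf.1 x ∂m = (∫ x, b.1 x ∂m) * integralH2 A m f := fun {b bf f} h => by
    rw [← hm.1.integralH2_mulH2, integralH2_apply]
    exact integral_congr_ae (h.trans (coeFn_mulH2 b f).symm)
  have hcomm : mulH2 A m bf (mulH2 A m d g) = mulH2 A m dg (mulH2 A m b f) := by
    refine Subtype.ext (Lp.ext ?_)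
    filter_upwards [hbf, hdg, coeFn_mulH2 bf (mulH2 A m d g), coeFn_mulH2 d g.1,
      coeFn_mulH2 dg (mulH2 A m b f), coeFn_mulH2 b f.1] with x h1 h2 h3 h4 h5 h6
    rw [h3, h4, h5, h6, h1, h2]
    ring
  have h1 : mulH2 A m bf (mulH2 A m d (L g)) = mulH2 A m dg (mulH2 A m b (L f)) := by
    rw [← hL, ← hL, ← hL, ← hL]
    exact congrArg L (Subtype.ext hcomm)
  have h2 := congrArg (integralH2 A m) h1
  simp only [hm.1.integralH2_mulH2] at h2
  rw [hint hbf, hint hdg] at h2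
  refine mul_left_cancel₀ (mul_ne_zero hb0 hd0) ?_
  linear_combination h2

theorem eq_top_of_isTransitive_of_ne_bot {H : Type*} [NormedAddCommGroup H] [InnerProductSpace ℂ H]
    {T : Subalgebra ℂ (H →L[ℂ] H)} (hT : IsTransitive T) {D : Submodule ℂ H}
    (hD : ∀ S ∈ T, ∀ v ∈ D, S v ∈ D) (h : D ≠ ⊥) : D.topologicalClosure = ⊤ := by
  refine (hT _ D.isClosed_topologicalClosure fun S hS v hv => ?_).resolve_left fun h0 => h ?_
  · exact map_mem_closure S.continuous hv (hD S hS)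
  · exact le_bot_iff.1 (h0 ▸ D.le_topologicalClosure)

theorem IsCoreMeasure.hasScalarTransformations [T2Space X] (hA : IsHypoDirichlet A)
    (hm : IsCoreMeasure φ m) {T : Subalgebra ℂ (H2 A m →L[ℂ] H2 A m)}
    (hST : Set.range (mulH2 A m) ⊆ T) (hT : IsTransitive T) : HasScalarTransformations T := by
  intro D L hD hL
  by_cases hbot : D = ⊥
  · subst hbot
    refine ⟨0, fun v => ?_⟩
    rw [Subsingleton.elim v 0]
    simp
  -- The integral is a continuous functional with value `φ(1) = 1` at the constant `1`, so no
  -- subspace of its kernel is dense.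
  have hne : ∀ R : Submodule ℂ (H2 A m), (∀ v ∈ R, integralH2 A m v = 0) →
      R.topologicalClosure ≠ ⊤ := fun R hR htop => by
    have h1 : R.topologicalClosure ≤ (integralH2 A m).ker :=
      R.topologicalClosure_minimal hR (integralH2 A m).isClosed_ker
    have h2 : toH2 A m 1 ∈ (integralH2 A m).ker := h1 (htop ▸ Submodule.mem_top)
    have h3 : integralH2 A m (toH2 A m 1) = 0 := h2
    rw [hm.1.integralH2_toH2, map_one] at h3
    exact one_ne_zero h3
  obtain ⟨f, hf⟩ : ∃ f : D, integralH2 A m f ≠ 0 := by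
    by_contra! h
    exact hne D (fun v hv => h ⟨v, hv⟩) (eq_top_of_isTransitive_of_ne_bot hT hD hbot)
  set c := integralH2 A m (L f) / integralH2 A m f
  refine ⟨c, fun v => ?_⟩
  let R := LinearMap.range (L - c • D.subtype)
  have hRinv : ∀ S ∈ T, ∀ v ∈ R, S v ∈ R := by
    rintro S hS _ ⟨v, rfl⟩
    refine ⟨⟨S v, hD S hS v v.2⟩, ?_⟩
    simp [hL S hS v]
  have hR0 : ∀ v ∈ R, integralH2 A m v = 0 := by
    rintro _ ⟨v, rfl⟩
    have h1 := hm.integralH2_mul_comm hA (fun h => hD _ (hST ⟨h, rfl⟩))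
      (fun h => hL _ (hST ⟨h, rfl⟩)) f v
    simp only [LinearMap.sub_apply, LinearMap.smul_apply, Submodule.subtype_apply, map_sub,
      map_smul, smul_eq_mul, c]
    field_simp
    linear_combination h1
  have hRbot : R = ⊥ := by
    by_contra h
    exact hne R hR0 (eq_top_of_isTransitive_of_ne_bot hT hRinv h)
  have hv : L v - c • (v : H2 A m) ∈ R := ⟨v, rfl⟩
  rwa [hRbot, Submodule.mem_bot, sub_eq_zero] at hv

end Multiplicativity

end HypoDirichlet

theorem theorem3p5 {X : Type*} [TopologicalSpace X] [CompactSpace X] [T2Space X]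
    [MeasurableSpace X] [BorelSpace X]
    (A : Subalgebra ℂ C(X, ℂ)) (hA : HypoDirichlet.IsHypoDirichlet A)
    (φ : A →ₐ[ℂ] ℂ) (m : Measure X) [IsFiniteMeasure m]
    (hm : HypoDirichlet.IsCoreMeasure φ m)
    (hR : HypoDirichlet.IsReproducingKernel A m) :
    HypoDirichlet.IsCatalytic (Set.range (HypoDirichlet.mulH2 A m)) := by
  intro T hST hT
  exact HypoDirichlet.isStronglyDense_of_hasScalarTransformations hT
    (hm.hasScalarTransformations hA hST hT)
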